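/- Let $d\ge 1$ and let $\nu$ be a probability distribution on $\mathbb R^d$ with $\int|x|^2\,d\nu(x)<\infty$. Let $\eta$ denote a random vector with law $\nu$, let $m:=\mathbb E\,\eta$, and let $\mu_0$ be an arbitrary non-zero finite (Borel) measure on $\mathbb R^d$. For a non-zero finite measure $\mu$ on $\mathbb R^d$ write $\tilde\mu:=\mu(\mathbb R^d)^{-1}\mu$. For $a>0$, $b\in\mathbb R^d$ and a probability measure $\mu$ on $\mathbb R^d$, let $\Theta_{a,b}(\mu)$ be the law of $(Z-b)/a$, where $Z$ has law $\mu$. Consider random finite measures $\mu_0,\mu_1,\mu_2,\dots$ on $\mathbb R^d$, starting from the given $\mu_0$ and evolving in one of the following two ways. At each step $n\ge 0$, given everything that has happened so far, a colour $X_n\in\mathbb R^d$ is drawn with distribution $\tilde\mu_n$, and then * (single ball addition random walk Pólya urn) $\mu_{n+1}:=\mu_n+\delta_{X_n+\eta_n}$, where $\eta_n$ has law $\nu$ and is independent of $X_n$ and of everything that has happened before (in particular, the offsets $\eta_0,\eta_1,\dots$ are i.i.d. with law $\nu$); or * (deterministic addition random walk Pólya urn) $\mu_{n+1}:=\mu_n+\mathfrak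 r_{X_n}$, where $\mathfrak r_x$ denotes the law of $x+\eta$. Then, in each of the two cases, almost surely, as $n\to\infty$, $$\Theta_{\sqrt{\log n},\;m\log n}(\tilde\mu_n)\to N\bigl(0,\mathbb E[\eta\eta^{\mathsf T}]\bigr)$$ in the space $\mathcal P(\mathbb R^d)$ of Borel probability measures on $\mathbb R^d$ with the usual weak topology. -/

import Mathlib

open MeasureTheory ProbabilityTheory Filter Topology

noncomputable section

/-- The unit point mass at `x`, as a finite measure. -/
def pointMass {S : Type*} [MeasurableSpace S] (x : S) : FiniteMeasure S :=
  ⟨Measure.dirac x, inferInstance⟩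

/-- `(μ n)` is a measure-valued Pólya urn process on the colour space `S`, with initial
composition `μ₀`, in which the ball drawn at time `n` has colour `X n` and the mass added to the
urn after this draw is `R n`. The σ-algebra `ℱ n` is the history up to time `n`: it contains
the composition at time `n` and all earlier draws. Given this history, the colour `X n` is chosen
according to the normalized composition at time `n`. -/
structure IsPolyaUrn {S Ω : Type*} [MeasurableSpace S] [Nonempty S] {mΩ : MeasurableSpace Ω}
    (P : Measure Ω) (ℱ : Filtration ℕ mΩ) (μ₀ : FiniteMeasure S)
    (μ : ℕ → Ω → FiniteMeasure S) (X : ℕ → Ω → S) (R : ℕ → Ω → FiniteMeasure S) : Prop where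
  initial : ∀ᵐ ω ∂P, μ 0 ω = μ₀
  measurable_composition : ∀ n, Measurable[ℱ n] (μ n)
  measurable_draw : ∀ n, Measurable[ℱ (n + 1)] (X n)
  draw : ∀ (n : ℕ) (A : Set S), MeasurableSet A →
    P⟦X n ⁻¹' A | ℱ n⟧ =ᵐ[P] fun ω => ((μ n ω).normalize : Measure S).real A
  update : ∀ n, ∀ᵐ ω ∂P, μ (n + 1) ω = μ n ω + R n ω

/-- Single ball addition random walk Pólya urn with offset distribution `ν`: when a ball of colour
`X n` is drawn, one ball of colour `X n + η n` is added, where `η n` has law `ν` and is independent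
of the draw `X n` and of the history. In particular, the offsets `η n` are i.i.d., since the
history at time `n` contains all earlier offsets. -/
structure IsSRWPolyaUrn {d : ℕ} {Ω : Type*}
    {mΩ : MeasurableSpace Ω} (P : Measure Ω) (ℱ : Filtration ℕ mΩ)
    (ν : Measure (EuclideanSpace ℝ (Fin d)))
    (μ₀ : FiniteMeasure (EuclideanSpace ℝ (Fin d)))
    (μ : ℕ → Ω → FiniteMeasure (EuclideanSpace ℝ (Fin d)))
    (X η : ℕ → Ω → EuclideanSpace ℝ (Fin d)) : Prop where
  isPolyaUrn : IsPolyaUrn P ℱ μ₀ μ X (fun n ω => pointMass (X n ω + η n ω))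
  measurable_offset : ∀ n, Measurable[ℱ (n + 1)] (η n)
  offset_law : ∀ n, P.map (η n) = ν
  offset_indep : ∀ n, Indep (MeasurableSpace.comap (η n) inferInstance)
    (ℱ n ⊔ MeasurableSpace.comap (X n) inferInstance) P

/-- Deterministic addition random walk Pólya urn with offset distribution `ν`: when a ball of colour
`x = X n` is drawn, the law of `x + Y` is added, where `Y` has law `ν` (a translate of `ν`). -/
def IsDRWPolyaUrn {d : ℕ} {Ω : Type*}
    {mΩ : MeasurableSpace Ω} (P : Measure Ω) (ℱ : Filtration ℕ mΩ)
    (ν : Measure (EuclideanSpace ℝ (Fin d))) [IsProbabilityMeasure ν]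
    (μ₀ : FiniteMeasure (EuclideanSpace ℝ (Fin d)))
    (μ : ℕ → Ω → FiniteMeasure (EuclideanSpace ℝ (Fin d)))
    (X : ℕ → Ω → EuclideanSpace ℝ (Fin d)) : Prop :=
  IsPolyaUrn P ℱ μ₀ μ X (fun n ω => ⟨ν.map (fun y => X n ω + y), inferInstance⟩)

/-- The rescaling map `Θ_{a,b}`: if `Z` has law `μ` then `(Z - b) / a` has law `rescale a b μ`. -/
def rescale {d : ℕ} (a : ℝ) (b : EuclideanSpace ℝ (Fin d))
    (μ : ProbabilityMeasure (EuclideanSpace ℝ (Fin d))) :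
    ProbabilityMeasure (EuclideanSpace ℝ (Fin d)) :=
  μ.map (f := fun x => a⁻¹ • (x - b)) (by fun_prop)

/-- The second moment matrix `E[η ηᵀ]` of a random vector `η` of law `ν`. -/
def secondMomentMatrix {d : ℕ} (ν : Measure (EuclideanSpace ℝ (Fin d))) :
    Matrix (Fin d) (Fin d) ℝ :=
  Matrix.of fun i j => ∫ x, x i * x j ∂ν

/-- The centred normal distribution on `ℝ^d` with covariance matrix `C` (positive semidefinite,
possibly singular). -/
def centredNormal {d : ℕ} (C : Matrix (Fin d) (Fin d) ℝ) :
    ProbabilityMeasure (EuclideanSpace ℝ (Fin d)) :=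
  ⟨multivariateGaussian 0 C, inferInstance⟩

end

/-! Both urns give normalized compositions `π n` that solve one recursion: `π (n + 1)` mixes `π n`,
with weight `(w + n) / (w + n + 1)`, and a random `R n` whose conditional mean given the past is `π
n ∗ ν`, where `w` is the initial mass. Writing `φ` for the characteristic function of `ν`, that of
`π n` at `s` is therefore multiplied on average by `1 - (1 - φ s) / (w + n + 1)` at each step, with
noise of order `1 / n`. The noise after time `N` has variance at most `4 / N`, uniformly in `s`
(`integral_norm_sq_charFun_sub_le`).

The product of these factors from `N` to `n` is close to `exp (-(1 - φ s) log n)`. At `s = t / √(log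
n)`, a Taylor expansion of `φ` leaves `exp (-E⟪η, t⟫² / 2)` after centring. The exponent contains `φ
- 1` and not `log φ`, so the limit has the second moment matrix and not the covariance matrix of
`η`.

The starting value at time `N` is negligible if `π N` lives on a scale not exceeding `√(log n)`; a
supermartingale of truncated norms shows this without any moment of `μ₀`
(`ae_tendsto_integral_truncatedNorm`). With `N = i ^ 2` and `n ≈ exp √i` the variances are summable,
while `log N` and the spread at time `N` remain small enough. This gives almost sure convergence
along sparse times for each `t`, then for all `t` simultaneously by Fubini and positive
definiteness. Consecutive sparse times have ratio tending to `1`, and the composition changes little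
between them, so all times follow. -/

open scoped InnerProductSpace

set_option linter.unusedSectionVars false

/-! ### Integration against mixtures of measures, and conditional orthogonality -/

section Bind

variable {α β F : Type*} {mα : MeasurableSpace α} {mβ : MeasurableSpace β}
  [NormedAddCommGroup F] [NormedSpace ℝ F]

lemma integral_bind_of_bounded {m : Measure α} [IsFiniteMeasure m] {κ : α → Measure β}
    (hκ : Measurable κ) [hp : ∀ a, IsProbabilityMeasure (κ a)] {h : β → F}
    (hm : StronglyMeasurable h) {C : ℝ} (hC : ∀ x, ‖h x‖ ≤ C) :
    ∫ x, h x ∂(m.bind κ) = ∫ a, ∫ x, h x ∂(κ a) ∂m := by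
  let K : Kernel α β := ⟨κ, hκ⟩
  have : IsMarkovKernel K := ⟨hp⟩
  have hi : Integrable h (K ∘ₘ m) :=
    Integrable.of_bound hm.aestronglyMeasurable C (.of_forall hC)
  change ∫ x, h x ∂(K ∘ₘ m) = ∫ a, ∫ x, h x ∂(K a) ∂m
  rw [Measure.comp_eq_comp_const_apply] at hi ⊢
  rw [Kernel.integral_comp hi, Kernel.const_apply]

lemma stronglyMeasurable_integral_of_measurable {κ : α → Measure β} (hκ : Measurable κ)
    {h : β → F} (hm : StronglyMeasurable h) : StronglyMeasurable fun a ↦ ∫ x, h x ∂(κ a) :=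
  StronglyMeasurable.integral_kernel (κ := (⟨κ, hκ⟩ : Kernel α β)) hm

lemma isFiniteMeasure_bind {m : Measure α} [IsFiniteMeasure m] {κ : α → Measure β}
    (hκ : Measurable κ) [hp : ∀ a, IsProbabilityMeasure (κ a)] :
    IsFiniteMeasure (m.bind κ) := by
  let K : Kernel α β := ⟨κ, hκ⟩
  have : IsMarkovKernel K := ⟨hp⟩
  exact inferInstanceAs (IsFiniteMeasure (K ∘ₘ m))

lemma norm_integral_le_of_bounded {m : Measure α} [IsProbabilityMeasure m] {h : α → F} {C : ℝ}
    (hC : ∀ x, ‖h x‖ ≤ C) : ‖∫ x, h x ∂m‖ ≤ C := by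
  simpa using norm_integral_le_of_norm_le_const (μ := m) (.of_forall hC)

end Bind

/-- The last hypothesis identifies `G` as the conditional expectation of `Y` given `m`, and a
bounded `m`-measurable factor can be pulled out. This is the orthogonality of a martingale increment
to the past. -/
lemma integral_mul_sub_eq_zero_of_setIntegral_eq {Ω : Type*} {m mΩ : MeasurableSpace Ω}
    (hm : m ≤ mΩ) {P : Measure Ω} [IsFiniteMeasure P] {Z Y G : Ω → ℂ} (hZ : StronglyMeasurable[m] Z)
    {C : ℝ} (hC : ∀ ω, ‖Z ω‖ ≤ C) (hY : Integrable Y P) (hG : Integrable G P)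
    (hGm : StronglyMeasurable[m] G)
    (h : ∀ A, MeasurableSet[m] A → ∫ ω in A, Y ω ∂P = ∫ ω in A, G ω ∂P) :
    ∫ ω, Z ω * (Y ω - G ω) ∂P = 0 := by
  have hce : G =ᵐ[P] P[Y | m] :=
    ae_eq_condExp_of_forall_setIntegral_eq hm hY (fun s _ _ ↦ hG.integrableOn)
      (fun s hs _ ↦ (h s hs).symm) hGm.aestronglyMeasurable
  have hZm : AEStronglyMeasurable Z P := (hZ.mono hm).aestronglyMeasurable
  have hZY : Integrable (fun ω ↦ Z ω * Y ω) P := hY.bdd_mul hZm (.of_forall hC)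
  have hZG : Integrable (fun ω ↦ Z ω * G ω) P := hG.bdd_mul hZm (.of_forall hC)
  have h1 := condExp_bilin_of_stronglyMeasurable_left (m := m) (μ := P)
    (ContinuousLinearMap.mul ℝ ℂ) hZ (by simpa using hZY) hY
  simp_rw [mul_sub]
  rw [integral_sub hZY hZG, sub_eq_zero, ← integral_condExp hm]
  refine integral_congr_ae ?_
  filter_upwards [h1, hce] with ω h2 h3
  simp only [ContinuousLinearMap.mul_apply'] at h2
  rw [h2, h3]

/-! ### Reinforced walks, the common form of the two urns -/

/-- A random sequence of probability measures `π n` on `E`, where `π (n + 1)` is the mixture with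
weights proportional to `w + n` and `1` of `π n` and of a random probability measure `R n`, whose
conditional expectation given the past is `π n ∗ ν`. -/
structure IsReinforcedWalk {E Ω : Type*} [AddMonoid E] [MeasurableSpace E]
    {mΩ : MeasurableSpace Ω} (P : Measure Ω) (ℱ : Filtration ℕ mΩ) (ν : Measure E) (w : ℝ)
    (π R : ℕ → Ω → Measure E) : Prop where
  weight_pos : 0 < w
  measurable_composition : ∀ n, Measurable[ℱ n] (π n)
  measurable_reinforcement : ∀ n, Measurable (R n)
  isProbabilityMeasure_composition : ∀ n ω, IsProbabilityMeasure (π n ω)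
  isProbabilityMeasure_reinforcement : ∀ n ω, IsProbabilityMeasure (R n ω)
  update : ∀ n : ℕ, ∀ᵐ ω ∂P, π (n + 1) ω =
    ENNReal.ofReal ((w + n) / (w + n + 1)) • π n ω + ENNReal.ofReal (1 / (w + n + 1)) • R n ω
  bind_reinforcement : ∀ n A, MeasurableSet[ℱ n] A →
    (P.restrict A).bind (R n) = ((P.restrict A).bind (π n)) ∗ ν

namespace IsReinforcedWalk

variable {E Ω F : Type*} [NormedAddCommGroup E] [InnerProductSpace ℝ E] [FiniteDimensional ℝ E]
  [MeasurableSpace E] [BorelSpace E] {mΩ : MeasurableSpace Ω} {P : Measure Ω}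
  [IsProbabilityMeasure P] {ℱ : Filtration ℕ mΩ} {ν : Measure E} [IsProbabilityMeasure ν] {w : ℝ}
  {π R : ℕ → Ω → Measure E} [NormedAddCommGroup F] [NormedSpace ℝ F]

lemma stronglyMeasurable_integral (hU : IsReinforcedWalk P ℱ ν w π R) (n : ℕ) {h : E → F}
    (hm : StronglyMeasurable h) : StronglyMeasurable[ℱ n] fun ω ↦ ∫ x, h x ∂(π n ω) :=
  stronglyMeasurable_integral_of_measurable (hU.measurable_composition n) hm

lemma norm_integral_composition_le (hU : IsReinforcedWalk P ℱ ν w π R) (n : ℕ) {h : E → F} {C : ℝ}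
    (hC : ∀ x, ‖h x‖ ≤ C) (ω : Ω) : ‖∫ x, h x ∂(π n ω)‖ ≤ C :=
  have := hU.isProbabilityMeasure_composition n ω
  norm_integral_le_of_bounded hC

lemma norm_integral_reinforcement_le (hU : IsReinforcedWalk P ℱ ν w π R) (n : ℕ) {h : E → F}
    {C : ℝ} (hC : ∀ x, ‖h x‖ ≤ C) (ω : Ω) : ‖∫ x, h x ∂(R n ω)‖ ≤ C :=
  have := hU.isProbabilityMeasure_reinforcement n ω
  norm_integral_le_of_bounded hC

lemma integrable_integral_composition (hU : IsReinforcedWalk P ℱ ν w π R) (n : ℕ) {h : E → F}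
    (hm : StronglyMeasurable h) {C : ℝ} (hC : ∀ x, ‖h x‖ ≤ C) :
    Integrable (fun ω ↦ ∫ x, h x ∂(π n ω)) P :=
  Integrable.of_bound
    ((hU.stronglyMeasurable_integral n hm).mono (ℱ.le n)).aestronglyMeasurable C
    (.of_forall (hU.norm_integral_composition_le n hC))

lemma integrable_integral_reinforcement (hU : IsReinforcedWalk P ℱ ν w π R) (n : ℕ) {h : E → F}
    (hm : StronglyMeasurable h) {C : ℝ} (hC : ∀ x, ‖h x‖ ≤ C) :
    Integrable (fun ω ↦ ∫ x, h x ∂(R n ω)) P :=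
  Integrable.of_bound
    (stronglyMeasurable_integral_of_measurable
      (hU.measurable_reinforcement n) hm).aestronglyMeasurable C
    (.of_forall (hU.norm_integral_reinforcement_le n hC))

/-- The exceptional null set is chosen before `h`, so that later bounds hold for all frequencies at
once. -/
lemma integral_update (hU : IsReinforcedWalk P ℱ ν w π R) (n : ℕ) :
    ∀ᵐ ω ∂P, ∀ (h : E → F) (C : ℝ), StronglyMeasurable h → (∀ x, ‖h x‖ ≤ C) →
      ∫ x, h x ∂(π (n + 1) ω) = ((w + n) / (w + n + 1)) • ∫ x, h x ∂(π n ω) +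
        (1 / (w + n + 1)) • ∫ x, h x ∂(R n ω) := by
  filter_upwards [hU.update n] with ω hω h C hm hC
  have hw := hU.weight_pos
  have := hU.isProbabilityMeasure_composition n ω
  have := hU.isProbabilityMeasure_reinforcement n ω
  have hi (m : Measure E) [IsProbabilityMeasure m] : Integrable h m :=
    Integrable.of_bound hm.aestronglyMeasurable C (.of_forall hC)
  rw [hω, integral_add_measure ((hi _).smul_measure (by simp)) ((hi _).smul_measure (by simp)),
    integral_smul_measure, integral_smul_measure, ENNReal.toReal_ofReal (by positivity),
    ENNReal.toReal_ofReal (by positivity)]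

/-- This tests `bind_reinforcement` on two kinds of functions: characters, for which the right side
factorises, and truncated norms, which are subadditive. -/
lemma setIntegral_reinforcement (hU : IsReinforcedWalk P ℱ ν w π R) (n : ℕ) {A : Set Ω}
    (hA : MeasurableSet[ℱ n] A) {h : E → F} (hm : StronglyMeasurable h) {C : ℝ}
    (hC : ∀ x, ‖h x‖ ≤ C) :
    ∫ ω in A, ∫ x, h x ∂(R n ω) ∂P = ∫ ω in A, ∫ x, ∫ y, h (x + y) ∂ν ∂(π n ω) ∂P := by
  have := hU.isProbabilityMeasure_composition n
  have := hU.isProbabilityMeasure_reinforcement n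
  have hπ : Measurable (π n) := (hU.measurable_composition n).mono (ℱ.le n) le_rfl
  have := isFiniteMeasure_bind (m := P.restrict A) hπ
  rw [← integral_bind_of_bounded (hU.measurable_reinforcement n) hm hC,
    hU.bind_reinforcement n A hA, integral_conv
      (Integrable.of_bound hm.aestronglyMeasurable C (.of_forall hC)),
    integral_bind_of_bounded hπ (C := C)]
  · exact StronglyMeasurable.integral_prod_right
      (f := fun x y : E ↦ h (x + y)) (hm.comp_measurable measurable_add)
  · exact fun x ↦ norm_integral_le_of_bounded fun y ↦ hC _

end IsReinforcedWalk

/-! ### Mean-square control of the characteristic functions -/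

/-- The factor by which the transform of the normalized composition grows on average at step `n`,
if the offset distribution has transform `φ` and the initial weight is `w`. -/
noncomputable def growthFactor (w : ℝ) (φ : ℂ) (n : ℕ) : ℂ := 1 - (1 - φ) / (w + n + 1)

/-- As a convex combination of `1` and `φ`, the factor stays in the unit disc whenever `φ` does. -/
lemma growthFactor_eq {w : ℝ} (hw : 0 < w) (φ : ℂ) (n : ℕ) :
    growthFactor w φ n = ((w + n) / (w + n + 1) : ℝ) + (1 / (w + n + 1) : ℝ) * φ := by
  have h : ((w : ℂ) + n + 1) ≠ 0 := by
    have : (0 : ℝ) < w + n + 1 := by positivity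
    exact_mod_cast this.ne'
  unfold growthFactor
  push_cast
  field_simp
  ring

lemma norm_growthFactor_le_one {w : ℝ} (hw : 0 < w) {φ : ℂ} (hφ : ‖φ‖ ≤ 1) (n : ℕ) :
    ‖growthFactor w φ n‖ ≤ 1 := by
  rw [growthFactor_eq hw]
  refine (norm_add_le _ _).trans ?_
  rw [norm_mul, Complex.norm_of_nonneg (by positivity), Complex.norm_of_nonneg (by positivity)]
  calc (w + n) / (w + n + 1) + 1 / (w + n + 1) * ‖φ‖
      ≤ (w + n) / (w + n + 1) + 1 / (w + n + 1) * 1 := by gcongr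
    _ = 1 := by field_simp

namespace IsReinforcedWalk

variable {E Ω : Type*} [NormedAddCommGroup E] [InnerProductSpace ℝ E] [FiniteDimensional ℝ E]
  [MeasurableSpace E] [BorelSpace E] {mΩ : MeasurableSpace Ω} {P : Measure Ω}
  [IsProbabilityMeasure P] {ℱ : Filtration ℕ mΩ} {ν : Measure E} [IsProbabilityMeasure ν] {w : ℝ}
  {π R : ℕ → Ω → Measure E}

lemma norm_charFun_composition_le (hU : IsReinforcedWalk P ℱ ν w π R) (n : ℕ) (ω : Ω) (s : E) :
    ‖charFun (π n ω) s‖ ≤ 1 :=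
  have := hU.isProbabilityMeasure_composition n ω
  norm_charFun_le_one s

lemma norm_charFun_reinforcement_le (hU : IsReinforcedWalk P ℱ ν w π R) (n : ℕ) (ω : Ω) (s : E) :
    ‖charFun (R n ω) s‖ ≤ 1 :=
  have := hU.isProbabilityMeasure_reinforcement n ω
  norm_charFun_le_one s

lemma stronglyMeasurable_cexp_inner (s : E) :
    StronglyMeasurable fun x : E ↦ Complex.exp (⟪x, s⟫_ℝ * Complex.I) :=
  Continuous.stronglyMeasurable (by fun_prop)

lemma norm_cexp_inner_le (s x : E) : ‖Complex.exp (⟪x, s⟫_ℝ * Complex.I)‖ ≤ 1 :=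
  (Complex.norm_exp_ofReal_mul_I _).le

lemma stronglyMeasurable_charFun_composition (hU : IsReinforcedWalk P ℱ ν w π R) (n : ℕ) (s : E) :
    StronglyMeasurable[ℱ n] fun ω ↦ charFun (π n ω) s :=
  hU.stronglyMeasurable_integral n (stronglyMeasurable_cexp_inner s)

lemma stronglyMeasurable_charFun_reinforcement (hU : IsReinforcedWalk P ℱ ν w π R) (n : ℕ)
    (s : E) : StronglyMeasurable fun ω ↦ charFun (R n ω) s :=
  stronglyMeasurable_integral_of_measurable (hU.measurable_reinforcement n)
    (stronglyMeasurable_cexp_inner s)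

lemma setIntegral_charFun_reinforcement (hU : IsReinforcedWalk P ℱ ν w π R) (n : ℕ) (s : E)
    {A : Set Ω} (hA : MeasurableSet[ℱ n] A) :
    ∫ ω in A, charFun (R n ω) s ∂P = ∫ ω in A, charFun ν s * charFun (π n ω) s ∂P := by
  simp only [charFun_apply (μ := R n _), charFun_apply (μ := π n _)]
  rw [hU.setIntegral_reinforcement n hA (stronglyMeasurable_cexp_inner s) (norm_cexp_inner_le s)]
  congr 1 with ω
  rw [← integral_const_mul]
  congr 1 with x
  rw [charFun_apply, ← integral_mul_const]
  congr 1 with y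
  rw [← Complex.exp_add, inner_add_left]
  push_cast
  ring_nf

/-- Drift plus noise: the second summand has conditional mean zero given `ℱ n`. -/
lemma charFun_composition_succ (hU : IsReinforcedWalk P ℱ ν w π R) (n : ℕ) (s : E) :
    ∀ᵐ ω ∂P, charFun (π (n + 1) ω) s = growthFactor w (charFun ν s) n * charFun (π n ω) s +
      (charFun (R n ω) s - charFun ν s * charFun (π n ω) s) / (w + n + 1) := by
  filter_upwards [hU.integral_update (F := ℂ) n] with ω hω
  have h1 := hω _ 1 (stronglyMeasurable_cexp_inner s) (norm_cexp_inner_le s)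
  simp only [← charFun_apply] at h1
  rw [h1, growthFactor_eq hU.weight_pos, Complex.real_smul, Complex.real_smul]
  push_cast
  ring

/-- The difference `W` obeys `W' = q W + D / c` with `‖q‖ ≤ 1`, `‖D‖ ≤ 2`, `c ≥ n + 1` and `D`
orthogonal to the past. Each step thus adds at most `4 / (n + 1) ^ 2`, which telescopes. Uniformity
in `s` matters because `s` will vary with `n`. -/
lemma integral_norm_sq_charFun_sub_le (hU : IsReinforcedWalk P ℱ ν w π R) (s : E) {N : ℕ}
    (hN : 0 < N) {n : ℕ} (hn : N ≤ n) :
    ∫ ω, ‖charFun (π n ω) s -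
      (∏ k ∈ Finset.Ico N n, growthFactor w (charFun ν s) k) * charFun (π N ω) s‖ ^ 2 ∂P
      ≤ 4 * (1 / N - 1 / n) := by
  have hw := hU.weight_pos
  set φ := charFun ν s
  have hφ : ‖φ‖ ≤ 1 := norm_charFun_le_one s
  induction n, hn using Nat.le_induction with
  | base => simp
  | succ n hn ih =>
    set Q := ∏ k ∈ Finset.Ico N n, growthFactor w φ k
    have hQ : ‖Q‖ ≤ 1 := by
      rw [norm_prod]
      exact Finset.prod_le_one (fun _ _ ↦ norm_nonneg _)
        fun k _ ↦ norm_growthFactor_le_one hw hφ k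
    set q := growthFactor w φ n
    have hq : ‖q‖ ≤ 1 := norm_growthFactor_le_one hw hφ n
    set W : Ω → ℂ := fun ω ↦ charFun (π n ω) s - Q * charFun (π N ω) s
    have hWm : StronglyMeasurable[ℱ n] W :=
      (hU.stronglyMeasurable_charFun_composition n s).sub
        (((hU.stronglyMeasurable_charFun_composition N s).mono (ℱ.mono hn)).const_mul Q)
    have hWb (ω) : ‖W ω‖ ≤ 2 := by
      refine (norm_sub_le _ _).trans ?_
      rw [norm_mul]
      have h1 := hU.norm_charFun_composition_le n ω s
      have h2 := hU.norm_charFun_composition_le N ω s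
      nlinarith [mul_le_mul hQ h2 (norm_nonneg _) zero_le_one]
    set D : Ω → ℂ := fun ω ↦ charFun (R n ω) s - φ * charFun (π n ω) s
    have hGm : StronglyMeasurable[ℱ n] fun ω ↦ φ * charFun (π n ω) s :=
      (hU.stronglyMeasurable_charFun_composition n s).const_mul φ
    have hGb (ω) : ‖φ * charFun (π n ω) s‖ ≤ 1 := by
      rw [norm_mul]
      exact mul_le_one₀ hφ (norm_nonneg _) (hU.norm_charFun_composition_le n ω s)
    have hDm : StronglyMeasurable D :=
      (hU.stronglyMeasurable_charFun_reinforcement n s).sub (hGm.mono (ℱ.le n))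
    have hDb (ω) : ‖D ω‖ ≤ 2 := by
      refine (norm_sub_le _ _).trans ?_
      linarith [hU.norm_charFun_reinforcement_le n ω s, hGb ω]
    have hWm' : StronglyMeasurable W := hWm.mono (ℱ.le n)
    have horth : ∫ ω, (starRingEnd ℂ) (W ω) * D ω ∂P = 0 := by
      refine integral_mul_sub_eq_zero_of_setIntegral_eq (ℱ.le n)
        (Complex.continuous_conj.comp_stronglyMeasurable hWm) (C := 2) (by simpa using hWb)
        (Integrable.of_bound
          (hU.stronglyMeasurable_charFun_reinforcement n s).aestronglyMeasurable 1
          (.of_forall fun ω ↦ hU.norm_charFun_reinforcement_le n ω s))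
        (Integrable.of_bound (hGm.mono (ℱ.le n)).aestronglyMeasurable 1 (.of_forall hGb)) hGm
        fun A hA ↦ hU.setIntegral_charFun_reinforcement n s hA
    set c : ℝ := w + n + 1
    have hc : 0 < c := by positivity
    have hcn : (n : ℝ) + 1 ≤ c := by simp only [c]; linarith
    have hn0 : (0 : ℝ) < n := by exact_mod_cast hN.trans_le hn
    -- The cross term is kept exactly, as a constant times `conj W * D`, since only its integral
    -- vanishes.
    have hstep : ∀ᵐ ω ∂P, ‖charFun (π (n + 1) ω) s -
        (∏ k ∈ Finset.Ico N (n + 1), growthFactor w φ k) * charFun (π N ω) s‖ ^ 2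
        ≤ ‖W ω‖ ^ 2 + 4 / (n + 1) ^ 2 +
          (((starRingEnd ℂ) q * 2 / (c : ℂ)) * ((starRingEnd ℂ) (W ω) * D ω)).re := by
      filter_upwards [hU.charFun_composition_succ n s] with ω hω
      have h1 : charFun (π (n + 1) ω) s -
          (∏ k ∈ Finset.Ico N (n + 1), growthFactor w φ k) * charFun (π N ω) s
          = q * W ω + D ω / (c : ℂ) := by
        rw [Finset.prod_Ico_succ_top hn, hω]
        simp only [W, D, c, Q, q]
        push_cast
        ring
      have h2 : ((starRingEnd ℂ) q * 2 / (c : ℂ)) * ((starRingEnd ℂ) (W ω) * D ω) =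
          2 * ((D ω / (c : ℂ)) * (starRingEnd ℂ) (q * W ω)) := by
        rw [map_mul]; ring
      have h3 : ‖q * W ω‖ ^ 2 ≤ ‖W ω‖ ^ 2 := by
        rw [norm_mul, mul_pow]
        exact mul_le_of_le_one_left (by positivity) (pow_le_one₀ (norm_nonneg _) hq)
      have h4 : ‖D ω / (c : ℂ)‖ ^ 2 ≤ 4 / (n + 1) ^ 2 := by
        rw [norm_div, Complex.norm_of_nonneg hc.le, div_pow]
        gcongr
        nlinarith [hDb ω, norm_nonneg (D ω)]
      have h5 : ‖q * W ω + D ω / (c : ℂ)‖ ^ 2 = ‖q * W ω‖ ^ 2 + ‖D ω / (c : ℂ)‖ ^ 2 +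
          2 * ((D ω / (c : ℂ)) * (starRingEnd ℂ) (q * W ω)).re := by
        simp only [← Complex.normSq_eq_norm_sq]
        rw [add_comm, Complex.normSq_add]
        ring
      rw [h1, h5, h2]
      have h6 : (2 * ((D ω / (c : ℂ)) * (starRingEnd ℂ) (q * W ω))).re =
          2 * ((D ω / (c : ℂ)) * (starRingEnd ℂ) (q * W ω)).re := by simp
      rw [h6]
      linarith
    have hi1 : Integrable (fun ω ↦ ‖W ω‖ ^ 2) P :=
      Integrable.of_bound (hWm'.norm.pow 2).aestronglyMeasurable 4 (.of_forall fun ω ↦ by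
        rw [Real.norm_of_nonneg (by positivity)]; nlinarith [hWb ω, norm_nonneg (W ω)])
    have hi2 : Integrable (fun ω ↦ ((starRingEnd ℂ) q * 2 / (c : ℂ)) *
        ((starRingEnd ℂ) (W ω) * D ω)) P := by
      refine Integrable.const_mul (Integrable.of_bound
        ((Complex.continuous_conj.comp_stronglyMeasurable hWm').mul hDm).aestronglyMeasurable 4
        (.of_forall fun ω ↦ ?_)) _
      rw [Pi.mul_apply, norm_mul, RCLike.norm_conj]
      nlinarith [hWb ω, hDb ω, norm_nonneg (W ω), norm_nonneg (D ω)]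
    have hi3 : Integrable (fun ω ↦ ‖W ω‖ ^ 2 + 4 / ((n : ℝ) + 1) ^ 2) P :=
      hi1.add (integrable_const _)
    have h7 : ∫ ω, (((starRingEnd ℂ) q * 2 / (c : ℂ)) *
        ((starRingEnd ℂ) (W ω) * D ω)).re ∂P = 0 := by
      have := integral_re hi2
      simp only [RCLike.re_to_complex] at this
      rw [this, integral_const_mul, horth]
      simp
    calc _ ≤ ∫ ω, (‖W ω‖ ^ 2 + 4 / ((n : ℝ) + 1) ^ 2 +
          (((starRingEnd ℂ) q * 2 / (c : ℂ)) * ((starRingEnd ℂ) (W ω) * D ω)).re) ∂P := by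
          refine integral_mono_of_nonneg (.of_forall fun _ ↦ by positivity) (hi3.add hi2.re) hstep
      _ = ∫ ω, ‖W ω‖ ^ 2 ∂P + 4 / ((n : ℝ) + 1) ^ 2 := by
          have := integral_add hi3 hi2.re
          simp only [RCLike.re_to_complex] at this
          rw [this, integral_add hi1 (integrable_const _), h7]
          simp
      _ ≤ 4 * (1 / N - 1 / n) + 4 * (1 / n - 1 / (n + 1)) := by
          gcongr
          rw [div_sub_div _ _ hn0.ne' (by positivity), mul_div_assoc',
            div_le_div_iff₀ (by positivity) (by positivity)]
          nlinarith
      _ = _ := by push_cast; ring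

end IsReinforcedWalk

/-! ### Spread of the composition -/

/-- An almost sure limit exists by martingale convergence of `-Z`; convergence in mean gives a
subsequence tending to zero, which identifies it. -/
lemma ae_tendsto_zero_of_supermartingale {Ω : Type*} {mΩ : MeasurableSpace Ω} {P : Measure Ω}
    [IsProbabilityMeasure P] {ℱ : Filtration ℕ mΩ} {Z : ℕ → Ω → ℝ} (hZ : Supermartingale Z ℱ P)
    (h0 : ∀ n ω, 0 ≤ Z n ω) (hlim : Tendsto (fun n ↦ ∫ ω, Z n ω ∂P) atTop (𝓝 0)) :
    ∀ᵐ ω ∂P, Tendsto (fun n ↦ Z n ω) atTop (𝓝 0) := by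
  have hnorm (n) : eLpNorm (Z n) 1 P = ENNReal.ofReal (∫ ω, Z n ω ∂P) := by
    rw [eLpNorm_one_eq_lintegral_enorm, ofReal_integral_eq_lintegral_ofReal (hZ.integrable n)
      (.of_forall (h0 n))]
    congr 1 with ω
    exact Real.enorm_of_nonneg (h0 n ω)
  have hbdd (n) : eLpNorm ((-Z) n) 1 P ≤ (Real.toNNReal (∫ ω, Z 0 ω ∂P) : NNReal) := by
    rw [Pi.neg_apply, eLpNorm_neg, hnorm]
    refine ENNReal.ofReal_le_ofReal ?_
    simpa using hZ.setIntegral_le (Nat.zero_le n) MeasurableSet.univ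
  have hconv := hZ.neg.exists_ae_tendsto_of_bdd hbdd
  have hmeas : TendstoInMeasure P Z atTop (fun _ ↦ 0) := by
    refine tendstoInMeasure_of_tendsto_eLpNorm one_ne_zero
      (fun n ↦ (hZ.integrable n).aestronglyMeasurable) aestronglyMeasurable_const ?_
    have : Tendsto (fun n ↦ eLpNorm (Z n) 1 P) atTop (𝓝 0) := by
      simp_rw [hnorm]
      simpa using ENNReal.tendsto_ofReal hlim
    refine this.congr fun n ↦ ?_
    congr 1
    ext ω
    simp
  obtain ⟨ns, hns, hsub⟩ := hmeas.exists_seq_tendsto_ae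
  filter_upwards [hconv, hsub] with ω ⟨c, h1⟩ h2
  have h3 : Tendsto (fun n ↦ Z n ω) atTop (𝓝 (-c)) := by simpa using h1.neg
  rwa [tendsto_nhds_unique (h3.comp hns.tendsto_atTop) h2] at h3

namespace IsReinforcedWalk

variable {E Ω : Type*} [NormedAddCommGroup E] [InnerProductSpace ℝ E] [FiniteDimensional ℝ E]
  [MeasurableSpace E] [BorelSpace E] {mΩ : MeasurableSpace Ω} {P : Measure Ω}
  [IsProbabilityMeasure P] {ℱ : Filtration ℕ mΩ} {ν : Measure E} [IsProbabilityMeasure ν] {w : ℝ}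
  {π R : ℕ → Ω → Measure E}

lemma stronglyMeasurable_truncatedNorm (K : ℝ) :
    StronglyMeasurable fun x : E ↦ min (‖x‖ / K) 1 :=
  Continuous.stronglyMeasurable (by fun_prop)

lemma norm_truncatedNorm_le {K : ℝ} (hK : 0 < K) (x : E) : ‖min (‖x‖ / K) 1‖ ≤ 1 := by
  rw [Real.norm_of_nonneg (by positivity)]
  exact min_le_right _ _

lemma integrable_truncatedNorm {K : ℝ} (hK : 0 < K) (m : Measure E) [IsFiniteMeasure m] :
    Integrable (fun x : E ↦ min (‖x‖ / K) 1) m :=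
  Integrable.of_bound (stronglyMeasurable_truncatedNorm K).aestronglyMeasurable 1
    (.of_forall (norm_truncatedNorm_le hK))

/-- Truncation preserves subadditivity of the norm and makes the integral finite for an arbitrary
initial composition. -/
lemma integral_truncatedNorm_add_le (hν : Integrable (fun x : E ↦ ‖x‖) ν) {K : ℝ} (hK : 0 < K)
    (x : E) : ∫ y, min (‖x + y‖ / K) 1 ∂ν ≤ min (‖x‖ / K) 1 + (∫ y, ‖y‖ ∂ν) / K := by
  calc ∫ y, min (‖x + y‖ / K) 1 ∂ν ≤ ∫ y, (min (‖x‖ / K) 1 + ‖y‖ / K) ∂ν := by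
        refine integral_mono_of_nonneg (.of_forall fun y ↦ by positivity)
          ((integrable_const _).add (hν.div_const K)) (.of_forall fun y ↦ ?_)
        have h1 : ‖x + y‖ / K ≤ ‖x‖ / K + ‖y‖ / K := by
          rw [← add_div]
          gcongr
          exact norm_add_le x y
        have h2 : 0 ≤ ‖y‖ / K := by positivity
        show min (‖x + y‖ / K) 1 ≤ min (‖x‖ / K) 1 + ‖y‖ / K
        rcases min_choice (‖x‖ / K) 1 with h | h <;> rw [h]
        · exact (min_le_left _ _).trans h1
        · exact (min_le_right _ _).trans (by linarith)
    _ = _ := by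
        rw [integral_add (integrable_const _) (hν.div_const K), integral_div]
        simp

/-- The reinforcement has weight `1 / (w + n + 1)`, and its extra displacement costs at most `E‖η‖ /
K`. The `w` is dropped in the final bound. -/
lemma setIntegral_truncatedNorm_succ_le (hU : IsReinforcedWalk P ℱ ν w π R)
    (hν : Integrable (fun x : E ↦ ‖x‖) ν) {K : ℝ} (hK : 0 < K) (n : ℕ) {A : Set Ω}
    (hA : MeasurableSet[ℱ n] A) :
    ∫ ω in A, ∫ x, min (‖x‖ / K) 1 ∂(π (n + 1) ω) ∂P ≤
      ∫ ω in A, (∫ x, min (‖x‖ / K) 1 ∂(π n ω) + (∫ y, ‖y‖ ∂ν) / ((n + 1) * K)) ∂P := by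
  have hw := hU.weight_pos
  set g : E → ℝ := fun x ↦ min (‖x‖ / K) 1
  set C := ∫ y, ‖y‖ ∂ν
  have hC : 0 ≤ C := integral_nonneg fun _ ↦ norm_nonneg _
  have hgm : StronglyMeasurable g := stronglyMeasurable_truncatedNorm K
  have hgb : ∀ x, ‖g x‖ ≤ 1 := norm_truncatedNorm_le hK
  have hiπ := (hU.integrable_integral_composition n hgm hgb).integrableOn (s := A)
  have hiR := (hU.integrable_integral_reinforcement n hgm hgb).integrableOn (s := A)
  have hR : ∫ ω in A, ∫ x, g x ∂(R n ω) ∂P ≤ ∫ ω in A, (∫ x, g x ∂(π n ω) + C / K) ∂P := by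
    rw [hU.setIntegral_reinforcement n hA hgm hgb]
    refine integral_mono_of_nonneg (.of_forall fun ω ↦ integral_nonneg fun x ↦
      integral_nonneg fun y ↦ ?_) (hiπ.add (integrable_const _)) (.of_forall fun ω ↦ ?_)
    · simp only [g]; positivity
    · have := hU.isProbabilityMeasure_composition n ω
      calc ∫ x, ∫ y, g (x + y) ∂ν ∂(π n ω) ≤ ∫ x, (g x + C / K) ∂(π n ω) := by
            refine integral_mono_of_nonneg (.of_forall fun x ↦ integral_nonneg fun y ↦ ?_)
              ((integrable_truncatedNorm hK _).add (integrable_const _))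
              (.of_forall (integral_truncatedNorm_add_le hν hK))
            simp only [g]; positivity
        _ = _ := by
            rw [integral_add (integrable_truncatedNorm hK _) (integrable_const _)]
            simp [g]
  have hiC : IntegrableOn (fun _ : Ω ↦ C / K) A P := (integrable_const _).integrableOn
  rw [integral_add hiπ hiC] at hR
  have hup : ∫ ω in A, ∫ x, g x ∂(π (n + 1) ω) ∂P =
      ((w + n) / (w + n + 1)) * ∫ ω in A, ∫ x, g x ∂(π n ω) ∂P +
        (1 / (w + n + 1)) * ∫ ω in A, ∫ x, g x ∂(R n ω) ∂P := by
    rw [← integral_const_mul, ← integral_const_mul,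
      ← integral_add (hiπ.const_mul _) (hiR.const_mul _)]
    refine integral_congr_ae (ae_restrict_of_ae ?_)
    filter_upwards [hU.integral_update (F := ℝ) n] with ω hω
    simpa using hω g 1 hgm hgb
  rw [hup, integral_add hiπ (integrable_const _)]
  simp only [integral_const, smul_eq_mul, MeasurableSet.univ, measureReal_restrict_apply,
    Set.univ_inter] at hR ⊢
  set p := P.real A
  have hp : 0 ≤ p := measureReal_nonneg
  set I := ∫ ω in A, ∫ x, g x ∂(π n ω) ∂P
  calc _ ≤ (w + n) / (w + n + 1) * I + 1 / (w + n + 1) * (I + p * (C / K)) := by gcongr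
    _ = I + p * (C / ((w + n + 1) * K)) := by field_simp; ring
    _ ≤ _ := by gcongr; linarith

lemma integral_truncatedNorm_le (hU : IsReinforcedWalk P ℱ ν w π R)
    (hν : Integrable (fun x : E ↦ ‖x‖) ν) {K : ℝ} (hK : 0 < K) (n : ℕ) :
    ∫ ω, ∫ x, min (‖x‖ / K) 1 ∂(π n ω) ∂P ≤ ∫ ω, ∫ x, min (‖x‖ / K) 1 ∂(π 0 ω) ∂P +
      (∫ y, ‖y‖ ∂ν) * ((∑ k ∈ Finset.range n, 1 / ((k : ℝ) + 1)) / K) := by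
  induction n with
  | zero => simp
  | succ n ih =>
    have h := hU.setIntegral_truncatedNorm_succ_le hν hK n MeasurableSet.univ
    have hi := hU.integrable_integral_composition n (stronglyMeasurable_truncatedNorm (E := E) K)
      (norm_truncatedNorm_le hK)
    rw [Measure.restrict_univ, integral_add hi (integrable_const _)] at h
    simp only [integral_const, probReal_univ, one_smul] at h
    rw [Finset.sum_range_succ]
    refine h.trans ((add_le_add_left ih _).trans_eq ?_)
    field_simp
    ring

/-- The composition at time `n` is concentrated on the scale `b n`, if `b` grows fast enough. -/
lemma ae_tendsto_integral_truncatedNorm (hU : IsReinforcedWalk P ℱ ν w π R)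
    (hν : Integrable (fun x : E ↦ ‖x‖) ν) {b : ℕ → ℝ} (hb : ∀ n, 0 < b n) (hmono : Monotone b)
    (htop : Tendsto b atTop atTop) (hsum : Summable fun n : ℕ ↦ 1 / (((n : ℝ) + 1) * b n))
    (hlim : Tendsto (fun n ↦ (∑ k ∈ Finset.range n, 1 / ((k : ℝ) + 1)) / b n) atTop (𝓝 0)) :
    ∀ᵐ ω ∂P, Tendsto (fun n ↦ ∫ x, min (‖x‖ / b n) 1 ∂(π n ω)) atTop (𝓝 0) := by
  set C := ∫ y, ‖y‖ ∂ν
  have hC : 0 ≤ C := integral_nonneg fun _ ↦ norm_nonneg _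
  set a : ℕ → ℝ := fun n ↦ C / (((n : ℝ) + 1) * b n)
  have ha0 (n) : 0 ≤ a n := by have := hb n; positivity
  have ha : Summable a := by
    simpa [a, div_eq_mul_inv] using hsum.mul_left C
  set T : ℕ → ℝ := fun n ↦ ∑' k, a (k + n)
  have hT0 (n) : 0 ≤ T n := tsum_nonneg fun _ ↦ ha0 _
  have hTlim : Tendsto T atTop (𝓝 0) := tendsto_sum_nat_add a
  have hTsucc (n) : T n = a n + T (n + 1) := by
    have := ((summable_nat_add_iff n).2 ha).tsum_eq_zero_add
    simp only [T]
    rw [this, zero_add]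
    congr 2 with k
    congr 1
    ring
  set U : ℕ → Ω → ℝ := fun n ω ↦ ∫ x, min (‖x‖ / b n) 1 ∂(π n ω)
  have hU0 (n ω) : 0 ≤ U n ω := integral_nonneg fun x ↦ by have := hb n; positivity
  have hUi (n) : Integrable (U n) P :=
    hU.integrable_integral_composition n (stronglyMeasurable_truncatedNorm (E := E) (b n))
      (norm_truncatedNorm_le (hb n))
  -- The drift at step `n` is at most `a n = T n - T (n + 1)`, so adding the tail sum `T`
  -- compensates it. Passing from scale `b n` to the larger `b (n + 1)` only decreases the integral.
  have hsuper : Supermartingale (fun n ω ↦ U n ω + T n) ℱ P := by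
    refine supermartingale_of_setIntegral_succ_le (fun n ↦
      (hU.stronglyMeasurable_integral n (stronglyMeasurable_truncatedNorm (E := E) (b n))).add
        stronglyMeasurable_const) (fun n ↦ (hUi n).add (integrable_const _)) fun n A hA ↦ ?_
    have h := hU.setIntegral_truncatedNorm_succ_le hν (hb n) n hA
    have hi := hU.integrable_integral_composition (n + 1)
      (stronglyMeasurable_truncatedNorm (E := E) (b n)) (norm_truncatedNorm_le (hb n))
    calc ∫ ω in A, (U (n + 1) ω + T (n + 1)) ∂P
        ≤ ∫ ω in A, (∫ x, min (‖x‖ / b n) 1 ∂(π (n + 1) ω) + T (n + 1)) ∂P := by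
          refine integral_mono ((hUi _).add (integrable_const _)).integrableOn
            (hi.add (integrable_const _)).integrableOn fun ω ↦ ?_
          have := hU.isProbabilityMeasure_composition (n + 1) ω
          refine add_le_add_left (integral_mono (integrable_truncatedNorm (hb _) _)
            (integrable_truncatedNorm (hb _) _) fun x ↦ ?_) _
          refine min_le_min_right _ (div_le_div_of_nonneg_left (norm_nonneg _) (hb n)
            (hmono n.le_succ))
      _ ≤ ∫ ω in A, (U n ω + a n) ∂P + ∫ ω in A, T (n + 1) ∂P := by
          rw [integral_add hi.integrableOn (integrable_const _)]
          gcongr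
      _ = _ := by
          have hi' : IntegrableOn (fun ω ↦ U n ω + a n) A P :=
            ((hUi n).add (integrable_const _)).integrableOn
          rw [← integral_add hi' (integrable_const _)]
          congr 1 with ω
          rw [hTsucc n, add_assoc]
  have hEU : Tendsto (fun n ↦ ∫ ω, U n ω ∂P) atTop (𝓝 0) := by
    have := hU.isProbabilityMeasure_composition 0
    have hπ0 : Measurable (π 0) := (hU.measurable_composition 0).mono (ℱ.le 0) le_rfl
    have := isFiniteMeasure_bind (m := P) hπ0
    -- Dominated convergence under the averaged initial law replaces a moment assumption on it.
    have hinit : Tendsto (fun n ↦ ∫ ω, ∫ x, min (‖x‖ / b n) 1 ∂(π 0 ω) ∂P) atTop (𝓝 0) := by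
      simp_rw [← integral_bind_of_bounded hπ0 (stronglyMeasurable_truncatedNorm (E := E) (b _))
        (norm_truncatedNorm_le (hb _))]
      rw [← integral_zero E ℝ (μ := P.bind (π 0))]
      refine tendsto_integral_of_dominated_convergence (fun _ ↦ 1)
        (fun n ↦ (stronglyMeasurable_truncatedNorm (b n)).aestronglyMeasurable)
        (integrable_const _) (fun n ↦ .of_forall (norm_truncatedNorm_le (hb n)))
        (.of_forall fun x ↦ ?_)
      have h := (htop.const_div_atTop ‖x‖).min (tendsto_const_nhds (x := (1 : ℝ)))
      simpa using h
    have hbound := hinit.add (hlim.const_mul C)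
    rw [mul_zero, add_zero] at hbound
    exact squeeze_zero (fun n ↦ integral_nonneg (hU0 n))
      (fun n ↦ hU.integral_truncatedNorm_le hν (hb n) n) hbound
  have hE : Tendsto (fun n ↦ ∫ ω, (U n ω + T n) ∂P) atTop (𝓝 0) := by
    have h := hEU.add hTlim
    rw [add_zero] at h
    refine h.congr fun n ↦ ?_
    rw [integral_add (hUi n) (integrable_const _)]
    simp
  filter_upwards [ae_tendsto_zero_of_supermartingale hsuper
    (fun n ω ↦ add_nonneg (hU0 n ω) (hT0 n)) hE] with ω hω
  exact squeeze_zero (fun n ↦ hU0 n ω) (fun n ↦ le_add_of_nonneg_right (hT0 n)) hω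

end IsReinforcedWalk

/-! ### Asymptotics of the product of growth factors -/

lemma norm_prod_sub_prod_le_sum {ι : Type*} (s : Finset ι) {a b : ι → ℂ}
    (ha : ∀ i ∈ s, ‖a i‖ ≤ 1) (hb : ∀ i ∈ s, ‖b i‖ ≤ 1) :
    ‖∏ i ∈ s, a i - ∏ i ∈ s, b i‖ ≤ ∑ i ∈ s, ‖a i - b i‖ := by
  classical
  induction s using Finset.induction_on with
  | empty => simp
  | insert j s hj ih =>
    simp only [Finset.mem_insert, forall_eq_or_imp] at ha hb
    rw [Finset.prod_insert hj, Finset.prod_insert hj, Finset.sum_insert hj,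
      show a j * ∏ i ∈ s, a i - b j * ∏ i ∈ s, b i = (a j - b j) * ∏ i ∈ s, a i
        + b j * (∏ i ∈ s, a i - ∏ i ∈ s, b i) by ring]
    have hp : ‖∏ i ∈ s, a i‖ ≤ 1 := by
      rw [norm_prod]
      exact Finset.prod_le_one (fun _ _ ↦ norm_nonneg _) ha.2
    refine (norm_add_le _ _).trans (add_le_add ?_ ?_)
    · rw [norm_mul]
      exact mul_le_of_le_one_right (norm_nonneg _) hp
    · rw [norm_mul]
      exact (mul_le_of_le_one_left (norm_nonneg _) hb.1).trans (ih ha.2 hb.2)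

lemma sum_Ico_one_div_sq_le {N n : ℕ} (hN : 0 < N) (hn : N ≤ n) :
    ∑ k ∈ Finset.Ico N n, 1 / ((k : ℝ) + 1) ^ 2 ≤ 1 / (N : ℝ) - 1 / n := by
  induction n, hn using Nat.le_induction with
  | base => simp
  | succ n hn ih =>
    rw [Finset.sum_Ico_succ_top hn]
    have hn0 : (0 : ℝ) < n := by exact_mod_cast hN.trans_le hn
    have h : 1 / ((n : ℝ) + 1) ^ 2 ≤ 1 / n - 1 / (n + 1) := by
      rw [div_sub_div _ _ hn0.ne' (by positivity), div_le_div_iff₀ (by positivity) (by positivity)]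
      nlinarith
    push_cast
    linarith

/-- All factors of both products lie in the unit disc, as `Re (1 - φ) ≥ 0`, so the factorwise errors
`‖x‖ ^ 2 ≤ 4 / (k + 1) ^ 2` may be summed. -/
lemma norm_prod_growthFactor_sub_exp_le {w : ℝ} (hw : 0 < w) {φ : ℂ} (hφ : ‖φ‖ ≤ 1) {N n : ℕ}
    (hN : 0 < N) (hn : N ≤ n) :
    ‖∏ k ∈ Finset.Ico N n, growthFactor w φ k -
      Complex.exp (-(1 - φ) * (∑ k ∈ Finset.Ico N n, 1 / (w + k + 1) : ℝ))‖ ≤ 4 / N := by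
  have hz2 : ‖1 - φ‖ ≤ 2 := (norm_sub_le _ _).trans (by rw [norm_one]; linarith)
  have hre : 0 ≤ (1 - φ).re := by
    rw [Complex.sub_re, Complex.one_re]
    linarith [(Complex.re_le_norm φ).trans hφ]
  have hexp : Complex.exp (-(1 - φ) * (∑ k ∈ Finset.Ico N n, 1 / (w + k + 1) : ℝ)) =
      ∏ k ∈ Finset.Ico N n, Complex.exp (-((1 - φ) / (w + k + 1))) := by
    rw [← Complex.exp_sum]
    push_cast
    rw [Finset.mul_sum]
    congr 1
    refine Finset.sum_congr rfl fun k _ ↦ ?_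
    ring
  rw [hexp]
  refine (norm_prod_sub_prod_le_sum _ (fun k _ ↦ norm_growthFactor_le_one hw hφ k)
    fun k _ ↦ ?_).trans ?_
  · rw [Complex.norm_exp, Real.exp_le_one_iff, Complex.neg_re, neg_nonpos]
    have : ((1 - φ) / ((w : ℂ) + k + 1)).re = (1 - φ).re / (w + k + 1) := by
      rw [← Complex.div_ofReal_re]
      push_cast
      rfl
    rw [this]
    positivity
  · calc ∑ k ∈ Finset.Ico N n, ‖growthFactor w φ k - Complex.exp (-((1 - φ) / (w + k + 1)))‖
        ≤ ∑ k ∈ Finset.Ico N n, 4 * (1 / ((k : ℝ) + 1) ^ 2) := by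
          refine Finset.sum_le_sum fun k hk ↦ ?_
          -- This ensures `2 / (k + 1) ≤ 1`, the range of the quadratic estimate for `exp`.
          have hk1 : (1 : ℝ) ≤ k := by exact_mod_cast hN.trans_le (Finset.mem_Ico.1 hk).1
          set x := (1 - φ) / ((w : ℂ) + k + 1)
          have hx : ‖x‖ ≤ 2 / (k + 1) := by
            have : ‖(w : ℂ) + k + 1‖ = w + k + 1 := by
              rw [show (w : ℂ) + k + 1 = ((w + k + 1 : ℝ) : ℂ) by push_cast; rfl,
                Complex.norm_of_nonneg (by positivity)]
            simp only [x, norm_div, this]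
            gcongr
            linarith
          have hx1 : ‖-x‖ ≤ 1 := by
            rw [norm_neg]
            refine hx.trans ?_
            rw [div_le_one (by positivity)]
            linarith
          have h := Complex.norm_exp_sub_one_sub_id_le hx1
          rw [growthFactor, show 1 - x - Complex.exp (-x) = -(Complex.exp (-x) - 1 - -x) by ring,
            norm_neg]
          refine h.trans ?_
          rw [norm_neg]
          calc ‖x‖ ^ 2 ≤ (2 / (k + 1)) ^ 2 := by gcongr
            _ = _ := by rw [div_pow]; ring
      _ ≤ 4 * (1 / N - 1 / n) := by
          rw [← Finset.mul_sum]
          gcongr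
          exact sum_Ico_one_div_sq_le hN hn
      _ ≤ 4 / N := by
          have : (0 : ℝ) ≤ 1 / n := by positivity
          rw [mul_sub, mul_one_div]
          linarith

/-- The sum lies between two telescoping differences of logarithms. The error may grow with `N`, but
not with `n`. -/
lemma abs_sum_Ico_sub_log_le {w : ℝ} (hw : 0 < w) {N n : ℕ} (hN : 0 < N) (hn : N ≤ n) :
    |∑ k ∈ Finset.Ico N n, 1 / (w + k + 1) - Real.log n| ≤ w + Real.log (N + w + 1) := by
  have hN1 : (1 : ℝ) ≤ N := by exact_mod_cast hN
  have hn1 : (1 : ℝ) ≤ n := by exact_mod_cast hN.trans_le hn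
  have key : Real.log (n + w + 1) - Real.log (N + w + 1) ≤ ∑ k ∈ Finset.Ico N n, 1 / (w + k + 1) ∧
      ∑ k ∈ Finset.Ico N n, 1 / (w + k + 1) ≤ Real.log (n + w) - Real.log (N + w) := by
    clear hn1
    induction n, hn using Nat.le_induction with
    | base => simp
    | succ n hn ih =>
      have hn1 : (1 : ℝ) ≤ n := by exact_mod_cast hN.trans_le hn
      rw [Finset.sum_Ico_succ_top hn]
      push_cast
      have h1 : Real.log (n + 1 + w + 1) - Real.log (n + w + 1) ≤ 1 / (w + n + 1) := by
        rw [← Real.log_div (by positivity) (by positivity)]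
        refine (Real.log_le_sub_one_of_pos (by positivity)).trans_eq ?_
        field_simp
        ring
      have h2 : 1 / (w + n + 1) ≤ Real.log (n + 1 + w) - Real.log (n + w) := by
        have h := Real.log_le_sub_one_of_pos (show (0 : ℝ) < (n + w) / (n + 1 + w) by positivity)
        rw [Real.log_div (by positivity) (by positivity)] at h
        have h3 : (n + w) / (n + 1 + w) - 1 = -(1 / (w + n + 1)) := by
          rw [show (n : ℝ) + 1 + w = w + n + 1 by ring]
          field_simp
          ring
        rw [h3] at h
        linarith
      constructor <;> linarith [ih.1, ih.2]
  have h1 : Real.log n ≤ Real.log (n + w + 1) := Real.log_le_log (by linarith) (by linarith)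
  have h2 : 0 ≤ Real.log (N + w) := Real.log_nonneg (by linarith)
  have h3 : 0 ≤ Real.log (N + w + 1) := Real.log_nonneg (by linarith)
  have h4 : Real.log (n + w) - Real.log n ≤ w := by
    rw [← Real.log_div (by positivity) (by positivity)]
    refine (Real.log_le_sub_one_of_pos (by positivity)).trans ?_
    rw [add_div, div_self (by positivity), add_sub_cancel_left]
    exact div_le_self hw.le hn1
  rw [abs_le]
  constructor <;> linarith [key.1, key.2]

section Expansion

variable {E : Type*} [NormedAddCommGroup E] [InnerProductSpace ℝ E] [FiniteDimensional ℝ E]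
  [MeasurableSpace E] [BorelSpace E] {ν : Measure E} [IsProbabilityMeasure ν]

lemma norm_one_sub_charFun_le (hν : Integrable (fun x : E ↦ ‖x‖) ν) (s : E) :
    ‖1 - charFun ν s‖ ≤ ‖s‖ * ∫ x, ‖x‖ ∂ν := by
  have h : 1 - charFun ν s = ∫ x, (1 - Complex.exp (⟪x, s⟫_ℝ * Complex.I)) ∂ν := by
    rw [integral_sub (integrable_const _), charFun_apply]
    · simp
    · exact Integrable.of_bound (Continuous.aestronglyMeasurable (by fun_prop)) 1
        (.of_forall fun x ↦ (Complex.norm_exp_ofReal_mul_I _).le)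
  rw [h, ← integral_const_mul]
  refine norm_integral_le_of_norm_le (hν.const_mul _) (.of_forall fun x ↦ ?_)
  rw [norm_sub_rev, mul_comm (_ : ℂ) Complex.I]
  refine Real.norm_exp_I_mul_ofReal_sub_one_le.trans ?_
  rw [mul_comm]
  exact norm_inner_le_norm x s

/-- Second-order Taylor expansion of the characteristic function of `⟪η, t⟫` at `u = 1 / √L`,
multiplied by `L`: the linear term becomes the subtracted phase, and the quadratic one gives the
limit. -/
lemma tendsto_mul_charFun_sub (hν : MemLp (fun x : E ↦ x) 2 ν) (t : E) {ι : Type*} {l : Filter ι}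
    {L : ι → ℝ} (hL : Tendsto L l atTop) :
    Tendsto (fun i ↦ (L i : ℂ) * (charFun ν ((√(L i))⁻¹ • t) - 1) -
      Complex.I * (⟪∫ x, x ∂ν, t⟫_ℝ * √(L i) : ℝ)) l
      (𝓝 (-(∫ x, ⟪x, t⟫_ℝ ^ 2 ∂ν : ℝ) / 2)) := by
  set X : E → ℝ := fun x ↦ ⟪x, t⟫_ℝ
  have hX : AEMeasurable X ν := by fun_prop
  have hint : MemLp id 2 (ν.map X) := by
    rw [memLp_map_measure_iff (by fun_prop) hX]
    exact hν.inner_const t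
  have := Measure.isProbabilityMeasure_map (μ := ν) hX
  have hmean : ν[X] = ⟪∫ x, x ∂ν, t⟫_ℝ := by
    have := integral_inner (𝕜 := ℝ) (hν.integrable one_le_two) t
    simp only [X]
    rw [real_inner_comm, ← this]
    exact integral_congr_ae (.of_forall fun x ↦ real_inner_comm _ _)
  have hchar (u : ℝ) : charFun (ν.map X) u = charFun ν (u • t) := by
    rw [charFun_apply_real, integral_map hX (by fun_prop), charFun_apply]
    congr 1 with x
    simp only [X, inner_smul_right]
    push_cast
    rfl
  have hlo : (fun u : ℝ ↦ charFun ν (u • t) -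
      (1 + (⟪∫ x, x ∂ν, t⟫_ℝ : ℝ) * u * Complex.I - (∫ x, ⟪x, t⟫_ℝ ^ 2 ∂ν : ℝ) * u ^ 2 / 2))
      =o[𝓝 0] fun u ↦ u ^ 2 := by
    have h2 : (∫ x, ⟪x, t⟫_ℝ ^ 2 ∂ν : ℝ) = ν[X ^ 2] := rfl
    rw [h2, ← hmean]
    simp_rw [← hchar, ← taylorWithinEval_charFun_two_zero hX hint]
    convert! taylor_isLittleO_univ (contDiff_charFun hint)
    simp
  have hu : Tendsto (fun i ↦ (√(L i))⁻¹) l (𝓝 0) :=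
    (Real.tendsto_sqrt_atTop.comp hL).inv_tendsto_atTop
  have h3 := ((Complex.isLittleO_ofReal_right.2 hlo).comp_tendsto hu).tendsto_div_nhds_zero
  have h4 := h3.add_const (-(∫ x, ⟪x, t⟫_ℝ ^ 2 ∂ν : ℝ) / 2 : ℂ)
  rw [zero_add] at h4
  refine h4.congr' ?_
  filter_upwards [hL.eventually_gt_atTop 0] with i hi
  have hs : (√(L i) : ℂ) ≠ 0 := by exact_mod_cast (Real.sqrt_pos.2 hi).ne'
  have hs2 : (L i : ℂ) = (√(L i) : ℂ) ^ 2 := by exact_mod_cast (Real.sq_sqrt hi.le).symm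
  simp only [Function.comp_apply]
  rw [hs2]
  push_cast
  field_simp
  ring

/-- The exponent is `-(1 - φ) S` with `S = log n + O(1 + log N)` and `1 - φ = O(1 / √(log n))`.
Hence `S` may be replaced by `log n` as soon as `log N = o(√(log n))`. -/
lemma tendsto_exp_mul_prod_growthFactor (hν : MemLp (fun x : E ↦ x) 2 ν) (t : E) {w : ℝ}
    (hw : 0 < w) {ι : Type*} {l : Filter ι} {N n : ι → ℕ} (hN : ∀ i, 0 < N i)
    (hn : ∀ i, N i ≤ n i) (hNtop : Tendsto N l atTop)
    (hL : Tendsto (fun i ↦ Real.log (n i)) l atTop)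
    (hlog : Tendsto (fun i ↦ Real.log (N i + w + 1) / √(Real.log (n i))) l (𝓝 0)) :
    Tendsto (fun i ↦ Complex.exp (-(Complex.I * (⟪∫ x, x ∂ν, t⟫_ℝ * √(Real.log (n i)) : ℝ))) *
      ∏ k ∈ Finset.Ico (N i) (n i),
        growthFactor w (charFun ν ((√(Real.log (n i)))⁻¹ • t)) k) l
      (𝓝 (Complex.exp (-(∫ x, ⟪x, t⟫_ℝ ^ 2 ∂ν : ℝ) / 2))) := by
  set L : ι → ℝ := fun i ↦ Real.log (n i)
  set φ : ι → ℂ := fun i ↦ charFun ν ((√(L i))⁻¹ • t)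
  set θ : ι → ℂ := fun i ↦ Complex.I * (⟪∫ x, x ∂ν, t⟫_ℝ * √(L i) : ℝ)
  set S : ι → ℝ := fun i ↦ ∑ k ∈ Finset.Ico (N i) (n i), 1 / (w + k + 1)
  have hν1 : Integrable (fun x : E ↦ ‖x‖) ν := (hν.integrable one_le_two).norm
  have hθ (i) : ‖Complex.exp (-θ i)‖ = 1 := by
    rw [show -θ i = ((-(⟪∫ x, x ∂ν, t⟫_ℝ * √(L i)) : ℝ) : ℂ) * Complex.I by
      simp only [θ]; push_cast; ring, Complex.norm_exp_ofReal_mul_I]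
  have herr : Tendsto (fun i ↦ Complex.exp (-θ i) *
      (∏ k ∈ Finset.Ico (N i) (n i), growthFactor w (φ i) k -
        Complex.exp (-(1 - φ i) * S i))) l (𝓝 0) := by
    refine squeeze_zero_norm (a := fun i ↦ 4 / (N i : ℝ)) (fun i ↦ ?_)
      ((tendsto_natCast_atTop_atTop.comp hNtop).const_div_atTop 4)
    rw [norm_mul, hθ, one_mul]
    exact norm_prod_growthFactor_sub_exp_le hw (norm_charFun_le_one _) (hN i) (hn i)
  have hsmall : Tendsto (fun i ↦ (1 - φ i) * ((S i - L i : ℝ) : ℂ)) l (𝓝 0) := by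
    have hlim : Tendsto (fun i ↦ ‖t‖ * (∫ x, ‖x‖ ∂ν) *
        (w / √(L i) + Real.log (N i + w + 1) / √(L i))) l (𝓝 0) := by
      have h1 : Tendsto (fun i ↦ w / √(L i)) l (𝓝 0) :=
        (Real.tendsto_sqrt_atTop.comp hL).const_div_atTop w
      simpa using (h1.add hlog).const_mul (‖t‖ * ∫ x, ‖x‖ ∂ν)
    refine squeeze_zero_norm (fun i ↦ ?_) hlim
    rw [norm_mul, Complex.norm_real, Real.norm_eq_abs]
    refine (mul_le_mul (norm_one_sub_charFun_le hν1 _)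
      (abs_sum_Ico_sub_log_le hw (hN i) (hn i)) (abs_nonneg _) (by positivity)).trans_eq ?_
    rw [norm_smul, norm_inv, Real.norm_of_nonneg (Real.sqrt_nonneg _)]
    ring
  have hmain := Complex.continuous_exp.continuousAt.tendsto.comp
    ((tendsto_mul_charFun_sub hν t hL).sub hsmall)
  have h := herr.add hmain
  rw [zero_add, sub_zero] at h
  refine h.congr fun i ↦ ?_
  have hexp : (L i : ℂ) * (φ i - 1) - θ i - (1 - φ i) * ((S i - L i : ℝ) : ℂ) =
      -θ i + -(1 - φ i) * S i := by
    push_cast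
    ring
  simp only [Function.comp_apply]
  rw [hexp, Complex.exp_add]
  ring

end Expansion

/-! ### Equicontinuity of characteristic functions -/

section CharFun

variable {E : Type*} [NormedAddCommGroup E] [InnerProductSpace ℝ E] [FiniteDimensional ℝ E]
  [MeasurableSpace E] [BorelSpace E]

lemma norm_charFun_sub_le (ρ : Measure E) [IsProbabilityMeasure ρ] (s t : E) :
    ‖charFun ρ s - charFun ρ t‖ ≤ ∫ x, ‖Complex.exp (⟪x, s - t⟫_ℝ * Complex.I) - 1‖ ∂ρ := by
  have hi (s : E) : Integrable (fun x ↦ Complex.exp (⟪x, s⟫_ℝ * Complex.I)) ρ :=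
    Integrable.of_bound (Continuous.aestronglyMeasurable (by fun_prop)) 1
      (.of_forall fun x ↦ (Complex.norm_exp_ofReal_mul_I _).le)
  rw [charFun_apply, charFun_apply, ← integral_sub (hi s) (hi t)]
  refine (norm_integral_le_integral_norm _).trans_eq ?_
  congr 1 with x
  have h : Complex.exp (⟪x, s⟫_ℝ * Complex.I) - Complex.exp (⟪x, t⟫_ℝ * Complex.I) =
      Complex.exp (⟪x, t⟫_ℝ * Complex.I) *
        (Complex.exp (⟪x, s - t⟫_ℝ * Complex.I) - 1) := by
    rw [mul_sub, ← Complex.exp_add, inner_sub_right]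
    push_cast
    ring_nf
  rw [h, norm_mul, Complex.norm_exp_ofReal_mul_I, one_mul]

lemma norm_cexp_sub_one_le (y : ℝ) : ‖Complex.exp (y * Complex.I) - 1‖ ≤ |y| := by
  rw [mul_comm]
  exact Real.norm_exp_I_mul_ofReal_sub_one_le

lemma norm_cexp_sub_one_le_two (y : ℝ) : ‖Complex.exp (y * Complex.I) - 1‖ ≤ 2 := by
  refine (norm_sub_le _ _).trans ?_
  rw [Complex.norm_exp_ofReal_mul_I, norm_one]
  norm_num

lemma integrable_norm_cexp_sub_one (ρ : Measure E) [IsProbabilityMeasure ρ] (u : E) :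
    Integrable (fun x ↦ ‖Complex.exp (⟪x, u⟫_ℝ * Complex.I) - 1‖) ρ :=
  Integrable.of_bound (Continuous.aestronglyMeasurable (by fun_prop)) 2
    (.of_forall fun x ↦ by rw [norm_norm]; exact norm_cexp_sub_one_le_two _)

/-- A consequence of the positive definiteness of characteristic functions. -/
lemma norm_charFun_sub_sq_le (ρ : Measure E) [IsProbabilityMeasure ρ] (s t : E) :
    ‖charFun ρ s - charFun ρ t‖ ^ 2 ≤ 2 * (1 - (charFun ρ (s - t)).re) := by
  set X : E → ℝ := fun x ↦ ‖Complex.exp (⟪x, s - t⟫_ℝ * Complex.I) - 1‖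
  have hX : MemLp X 2 ρ := MemLp.of_bound (Continuous.aestronglyMeasurable (by fun_prop)) 2
    (.of_forall fun x ↦ by simp only [X]; rw [norm_norm]; exact norm_cexp_sub_one_le_two _)
  -- Nonnegativity of the variance supplies `(E X)² ≤ E X²`.
  have hvar := variance_nonneg X ρ
  rw [variance_eq_sub hX] at hvar
  have hsq : ρ[X ^ 2] = 2 * (1 - (charFun ρ (s - t)).re) := by
    have hi : Integrable (fun x ↦ Complex.exp (⟪x, s - t⟫_ℝ * Complex.I)) ρ :=
      Integrable.of_bound (Continuous.aestronglyMeasurable (by fun_prop)) 1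
        (.of_forall fun x ↦ (Complex.norm_exp_ofReal_mul_I _).le)
    have hre := integral_re hi
    simp only [RCLike.re_to_complex] at hre
    have hi' : Integrable (fun x ↦ (Complex.exp (⟪x, s - t⟫_ℝ * Complex.I)).re) ρ := hi.re
    rw [charFun_apply, ← hre]
    calc ρ[X ^ 2] = ∫ x, 2 * (1 - (Complex.exp (⟪x, s - t⟫_ℝ * Complex.I)).re) ∂ρ := by
          congr 1 with x
          simp only [X, Pi.pow_apply]
          rw [← Complex.normSq_eq_norm_sq, Complex.normSq_sub, Complex.normSq_eq_norm_sq,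
            Complex.norm_exp_ofReal_mul_I]
          simp
          ring
      _ = _ := by
          rw [integral_const_mul, integral_sub (integrable_const _) hi']
          simp
  calc ‖charFun ρ s - charFun ρ t‖ ^ 2 ≤ (ρ[X]) ^ 2 := by
        gcongr
        exact norm_charFun_sub_le ρ s t
    _ ≤ ρ[X ^ 2] := by linarith
    _ = _ := hsq

/-- Almost everywhere convergence of characteristic functions to a characteristic function
improves to everywhere convergence. -/
lemma tendsto_charFun_of_ae {ρ : ℕ → Measure E} [∀ i, IsProbabilityMeasure (ρ i)] {γ : Measure E}
    [IsProbabilityMeasure γ] (m : Measure E) [m.IsAddHaarMeasure]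
    (h : ∀ᵐ t ∂m, Tendsto (fun i ↦ charFun (ρ i) t) atTop (𝓝 (charFun γ t))) (t : E) :
    Tendsto (fun i ↦ charFun (ρ i) t) atTop (𝓝 (charFun γ t)) := by
  rw [Metric.tendsto_nhds]
  intro ε hε
  have hcont : Continuous (charFun γ) := by fun_prop
  have h1 : ∀ᶠ t' in 𝓝 t, ‖charFun γ t' - charFun γ t‖ < ε / 3 := by
    have := Metric.tendsto_nhds.1 (hcont.tendsto t) (ε / 3) (by positivity)
    simpa only [dist_eq_norm] using this
  have h2 : ∀ᶠ t' in 𝓝 t, 2 * (1 - (charFun γ (t - t')).re) < (ε / 3) ^ 2 := by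
    have : Tendsto (fun t' ↦ 2 * (1 - (charFun γ (t - t')).re)) (𝓝 t) (𝓝 0) := by
      have hc : Continuous fun t' ↦ 2 * (1 - (charFun γ (t - t')).re) := by fun_prop
      simpa using hc.tendsto t
    exact this.eventually_lt_const (by positivity)
  -- The map `t' ↦ t - t'` respects null sets, so arbitrarily near `t` there is a `t'` with
  -- convergence at both `t'` and `t - t'`. The value at `t - t'` controls the increment from `t'`
  -- to `t`.
  have h3 := (quasiMeasurePreserving_sub_left m t).ae h
  obtain ⟨t', ⟨ht'1, ht'2⟩, ht'3, ht'4⟩ :=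
    (Measure.dense_of_ae (h.and h3)).inter_nhds_nonempty (h1.and h2)
  have h4 := ((Complex.continuous_re.tendsto _).comp ht'2).const_sub 1 |>.const_mul 2
  have h5 : ∀ᶠ i in atTop, ‖charFun (ρ i) t' - charFun γ t'‖ < ε / 3 := by
    have := Metric.tendsto_nhds.1 ht'1 (ε / 3) (by positivity)
    simpa only [dist_eq_norm] using this
  filter_upwards [h4.eventually_lt_const ht'4, h5] with i hi1 hi2
  have hi3 : ‖charFun (ρ i) t - charFun (ρ i) t'‖ < ε / 3 :=
    lt_of_pow_lt_pow_left₀ 2 (by positivity) ((norm_charFun_sub_sq_le (ρ i) t t').trans_lt hi1)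
  rw [dist_eq_norm]
  calc ‖charFun (ρ i) t - charFun γ t‖
      = ‖(charFun (ρ i) t - charFun (ρ i) t') + (charFun (ρ i) t' - charFun γ t') +
          (charFun γ t' - charFun γ t)‖ := by ring_nf
    _ ≤ ‖charFun (ρ i) t - charFun (ρ i) t'‖ + ‖charFun (ρ i) t' - charFun γ t'‖ +
          ‖charFun γ t' - charFun γ t‖ := norm_add₃_le
    _ < ε / 3 + ε / 3 + ε / 3 := by gcongr
    _ = ε := by ring

/-- On a compact set of radius `r` a character changes by at most `r ‖s - t‖`; outside, by at most
`2` on mass at most `ε / 4`. -/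
lemma exists_forall_norm_charFun_sub_lt {S : Set (Measure E)}
    (hS : IsTightMeasureSet S) (hp : ∀ ρ ∈ S, IsProbabilityMeasure ρ) {ε : ℝ} (hε : 0 < ε) :
    ∃ δ > 0, ∀ ρ ∈ S, ∀ s t : E, ‖s - t‖ < δ → ‖charFun ρ s - charFun ρ t‖ < ε := by
  obtain ⟨K, hK, hKS⟩ := isTightMeasureSet_iff_exists_isCompact_measure_compl_le.1 hS
    (ENNReal.ofReal (ε / 4)) (by simpa using hε)
  obtain ⟨r, hr0, hr⟩ := hK.isBounded.exists_pos_norm_le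
  refine ⟨ε / (2 * r), by positivity, fun ρ hρ s t hst ↦ ?_⟩
  have := hp ρ hρ
  have hKm : MeasurableSet Kᶜ := hK.isClosed.measurableSet.compl
  refine (norm_charFun_sub_le ρ s t).trans_lt ?_
  calc ∫ x, ‖Complex.exp (⟪x, s - t⟫_ℝ * Complex.I) - 1‖ ∂ρ
      ≤ ∫ x, (r * ‖s - t‖ + Kᶜ.indicator (fun _ ↦ (2 : ℝ)) x) ∂ρ := by
        refine integral_mono (integrable_norm_cexp_sub_one ρ _)
          ((integrable_const _).add ((integrable_const _).indicator hKm)) fun x ↦ ?_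
        by_cases hx : x ∈ K
        · rw [Set.indicator_of_notMem (by simpa using hx), add_zero]
          refine (norm_cexp_sub_one_le _).trans ((abs_real_inner_le_norm _ _).trans ?_)
          gcongr
          exact hr x hx
        · rw [Set.indicator_of_mem (by simpa using hx)]
          refine (norm_cexp_sub_one_le_two _).trans ?_
          have : 0 ≤ r * ‖s - t‖ := by positivity
          linarith
    _ = r * ‖s - t‖ + 2 * ρ.real Kᶜ := by
        rw [integral_add (integrable_const _) ((integrable_const _).indicator hKm),
          integral_indicator_const _ hKm]
        simp [mul_comm]
    _ < ε / 2 + 2 * (ε / 4) := by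
        have h1 : ρ.real Kᶜ ≤ ε / 4 :=
          ENNReal.toReal_le_of_le_ofReal (by positivity) (hKS ρ hρ)
        have h2 : r * ‖s - t‖ < ε / 2 := by
          rw [lt_div_iff₀ (by positivity)] at hst
          linarith
        linarith
    _ = ε := by ring

/-- Pointwise convergence to a continuous limit forces tightness, hence equicontinuity, so the
argument may move with the index. This absorbs the change of scale between nearby times. -/
lemma tendsto_charFun_comp_of_tendsto {ρ : ℕ → Measure E} [∀ i, IsProbabilityMeasure (ρ i)]
    {γ : Measure E} [IsProbabilityMeasure γ]
    (h : ∀ t, Tendsto (fun i ↦ charFun (ρ i) t) atTop (𝓝 (charFun γ t))) {ι : Type*} {l : Filter ι}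
    {k : ι → ℕ} (hk : Tendsto k l atTop) {s : ι → E} {t : E} (hs : Tendsto s l (𝓝 t)) :
    Tendsto (fun j ↦ charFun (ρ (k j)) (s j)) l (𝓝 (charFun γ t)) := by
  have htight : IsTightMeasureSet (Set.range ρ) :=
    isTightMeasureSet_of_tendsto_charFun (f := charFun γ) (by fun_prop) h
  have hd : Tendsto (fun j ↦ charFun (ρ (k j)) (s j) - charFun (ρ (k j)) t) l (𝓝 0) := by
    rw [Metric.tendsto_nhds]
    intro ε hε
    obtain ⟨δ, hδ, H⟩ := exists_forall_norm_charFun_sub_lt htight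
      (by rintro _ ⟨i, rfl⟩; infer_instance) hε
    filter_upwards [Metric.tendsto_nhds.1 hs δ hδ] with j hj
    rw [dist_zero_right]
    exact H _ ⟨k j, rfl⟩ _ _ (by rwa [← dist_eq_norm])
  simpa using hd.add ((h t).comp hk)

lemma norm_charFun_sub_one_le_truncatedNorm (ρ : Measure E) [IsProbabilityMeasure ρ] (s : E)
    {b : ℝ} (hb : 0 < b) :
    ‖charFun ρ s - 1‖ ≤ max (‖s‖ * b) 2 * ∫ x, min (‖x‖ / b) 1 ∂ρ := by
  have h := norm_charFun_sub_le ρ s 0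
  simp only [charFun_zero, probReal_univ, Complex.ofReal_one, sub_zero] at h
  refine h.trans ?_
  rw [← integral_const_mul]
  refine integral_mono (integrable_norm_cexp_sub_one ρ s)
    ((IsReinforcedWalk.integrable_truncatedNorm hb ρ).const_mul _) fun x ↦ ?_
  rcases min_cases (‖x‖ / b) 1 with ⟨h, -⟩ | ⟨h, -⟩ <;> simp only [h]
  · refine (norm_cexp_sub_one_le _).trans ((abs_real_inner_le_norm _ _).trans ?_)
    calc ‖x‖ * ‖s‖ = (‖s‖ * b) * (‖x‖ / b) := by field_simp
      _ ≤ _ := by gcongr; exact le_max_left _ _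
  · rw [mul_one]
    exact (norm_cexp_sub_one_le_two _).trans (le_max_right _ _)

end CharFun

/-! ### Almost sure convergence along sparse times, and interpolation -/

lemma ae_tendsto_zero_of_integral_sq_le {Ω : Type*} {mΩ : MeasurableSpace Ω} {P : Measure Ω}
    {f : ℕ → Ω → ℂ} (hf : ∀ i, AEStronglyMeasurable (f i) P)
    (hi : ∀ i, Integrable (fun ω ↦ ‖f i ω‖ ^ 2) P) {c : ℕ → ℝ} (hc : Summable c)
    (h : ∀ i, ∫ ω, ‖f i ω‖ ^ 2 ∂P ≤ c i) :
    ∀ᵐ ω ∂P, Tendsto (fun i ↦ f i ω) atTop (𝓝 0) := by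
  have hm (i) : AEMeasurable (fun ω ↦ ENNReal.ofReal (‖f i ω‖ ^ 2)) P :=
    ((hf i).norm.aemeasurable.pow_const 2).ennreal_ofReal
  have h1 : ∫⁻ ω, ∑' i, ENNReal.ofReal (‖f i ω‖ ^ 2) ∂P ≠ ⊤ := by
    rw [lintegral_tsum hm]
    refine ne_top_of_le_ne_top hc.tsum_ofReal_ne_top (ENNReal.tsum_le_tsum fun i ↦ ?_)
    rw [← ofReal_integral_eq_lintegral_ofReal (hi i) (.of_forall fun _ ↦ by positivity)]
    exact ENNReal.ofReal_le_ofReal (h i)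
  have h2 := ae_lt_top' (AEMeasurable.tsum hm) h1
  filter_upwards [h2] with ω hω
  have h3 := ENNReal.tendsto_atTop_zero_of_tsum_ne_top hω.ne
  have h4 := (ENNReal.tendsto_toReal ENNReal.zero_ne_top).comp h3
  have h5 : Tendsto (fun i ↦ ‖f i ω‖ ^ 2) atTop (𝓝 0) := by
    refine h4.congr fun i ↦ ?_
    simp only [Function.comp_apply]
    exact ENNReal.toReal_ofReal (sq_nonneg _)
  rw [tendsto_zero_iff_norm_tendsto_zero]
  have h6 := h5.sqrt
  simpa [Real.sqrt_sq] using h6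

section Rescaled

variable {E : Type*} [NormedAddCommGroup E] [InnerProductSpace ℝ E] [FiniteDimensional ℝ E]
  [MeasurableSpace E] [BorelSpace E]

/-- The characteristic function at `t` of the law of `(Z - L • m) / √L`, if `Z` has law `ρ`. -/
noncomputable def rescaledCharFun (m : E) (ρ : Measure E) (L : ℝ) (t : E) : ℂ :=
  Complex.exp (-(Complex.I * (⟪m, t⟫_ℝ * √L : ℝ))) * charFun ρ ((√L)⁻¹ • t)

lemma charFun_map_smul_sub (m : E) (ρ : Measure E) (L : ℝ) (t : E) :
    charFun (ρ.map fun x ↦ (√L)⁻¹ • (x - L • m)) t = rescaledCharFun m ρ L t := by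
  rw [charFun_apply, integral_map (by fun_prop)
    (Continuous.aestronglyMeasurable (by fun_prop)), rescaledCharFun, charFun_apply,
    ← integral_const_mul]
  congr 1 with x
  rw [← Complex.exp_add]
  congr 1
  rw [inner_smul_left, inner_sub_left, inner_smul_left, inner_smul_right]
  -- This holds for every real `L`: for `L ≤ 0` both sides are `0` by convention, so the times `0`
  -- and `1` need no separate treatment.
  have h : (√L)⁻¹ * L = √L := by rw [mul_comm, ← div_eq_mul_inv, Real.div_sqrt]
  have h' : ((√L : ℝ) : ℂ)⁻¹ * (L : ℂ) = (√L : ℝ) := by exact_mod_cast h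
  simp only [conj_trivial]
  push_cast
  linear_combination (-(⟪m, t⟫_ℝ : ℂ) * Complex.I) * h'

lemma norm_cexp_neg_I_mul (x : ℝ) : ‖Complex.exp (-(Complex.I * x))‖ = 1 := by
  rw [show -(Complex.I * (x : ℂ)) = ((-x : ℝ) : ℂ) * Complex.I by push_cast; ring,
    Complex.norm_exp_ofReal_mul_I]

end Rescaled

namespace IsReinforcedWalk

variable {E Ω : Type*} [NormedAddCommGroup E] [InnerProductSpace ℝ E] [FiniteDimensional ℝ E]
  [MeasurableSpace E] [BorelSpace E] {mΩ : MeasurableSpace Ω} {P : Measure Ω}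
  [IsProbabilityMeasure P] {ℱ : Filtration ℕ mΩ} {ν : Measure E} [IsProbabilityMeasure ν] {w : ℝ}
  {π R : ℕ → Ω → Measure E}

/-- The rescaled function is `c Q · charFun (π N) + c W`: the deterministic factor `c Q` has the
Gaussian limit, the initial value tends to `1`, and `W` vanishes because its variances are summable.
-/
lemma ae_tendsto_rescaledCharFun_of_sparse (hU : IsReinforcedWalk P ℱ ν w π R)
    (hν : MemLp (fun x : E ↦ x) 2 ν) {N n : ℕ → ℕ} (hN : ∀ i, 0 < N i) (hn : ∀ i, N i ≤ n i)
    (hNtop : Tendsto N atTop atTop) (hL : Tendsto (fun i ↦ Real.log (n i)) atTop atTop)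
    (hlog : Tendsto (fun i ↦ Real.log (N i + w + 1) / √(Real.log (n i))) atTop (𝓝 0))
    (hNsum : Summable fun i ↦ 1 / (N i : ℝ)) {b : ℕ → ℝ} (hb : ∀ n, 0 < b n)
    (hbU : ∀ᵐ ω ∂P, Tendsto (fun n ↦ ∫ x, min (‖x‖ / b n) 1 ∂(π n ω)) atTop (𝓝 0)) {B : ℝ}
    (hbN : ∀ i, b (N i) ≤ B * √(Real.log (n i))) (t : E) :
    ∀ᵐ ω ∂P, Tendsto (fun i ↦ rescaledCharFun (∫ x, x ∂ν) (π (n i) ω) (Real.log (n i)) t) atTop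
      (𝓝 (Complex.exp (-(∫ x, ⟪x, t⟫_ℝ ^ 2 ∂ν : ℝ) / 2))) := by
  set s : ℕ → E := fun i ↦ (√(Real.log (n i)))⁻¹ • t
  set Q : ℕ → ℂ := fun i ↦ ∏ k ∈ Finset.Ico (N i) (n i), growthFactor w (charFun ν (s i)) k
  set c : ℕ → ℂ := fun i ↦
    Complex.exp (-(Complex.I * (⟪∫ x, x ∂ν, t⟫_ℝ * √(Real.log (n i)) : ℝ)))
  have hdet : Tendsto (fun i ↦ c i * Q i) atTop
      (𝓝 (Complex.exp (-(∫ x, ⟪x, t⟫_ℝ ^ 2 ∂ν : ℝ) / 2))) :=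
    tendsto_exp_mul_prod_growthFactor hν t hU.weight_pos hN hn hNtop hL hlog
  set W : ℕ → Ω → ℂ := fun i ω ↦ charFun (π (n i) ω) (s i) - Q i * charFun (π (N i) ω) (s i)
  have hQ (i) : ‖Q i‖ ≤ 1 := by
    rw [norm_prod]
    exact Finset.prod_le_one (fun _ _ ↦ norm_nonneg _)
      fun k _ ↦ norm_growthFactor_le_one hU.weight_pos (norm_charFun_le_one _) k
  have hWm (i) : StronglyMeasurable (W i) :=
    ((hU.stronglyMeasurable_charFun_composition (n i) (s i)).mono (ℱ.le _)).sub
      (((hU.stronglyMeasurable_charFun_composition (N i) (s i)).mono (ℱ.le _)).const_mul (Q i))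
  have hWb (i ω) : ‖W i ω‖ ≤ 2 := by
    refine (norm_sub_le _ _).trans ?_
    rw [norm_mul]
    have h1 := hU.norm_charFun_composition_le (n i) ω (s i)
    have h2 := hU.norm_charFun_composition_le (N i) ω (s i)
    nlinarith [mul_le_mul (hQ i) h2 (norm_nonneg _) zero_le_one]
  have hW : ∀ᵐ ω ∂P, Tendsto (fun i ↦ W i ω) atTop (𝓝 0) := by
    refine ae_tendsto_zero_of_integral_sq_le (fun i ↦ (hWm i).aestronglyMeasurable)
      (fun i ↦ Integrable.of_bound ((hWm i).norm.pow 2).aestronglyMeasurable 4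
        (.of_forall fun ω ↦ ?_)) (hNsum.mul_left 4) fun i ↦ ?_
    · rw [Real.norm_of_nonneg (by positivity)]
      nlinarith [hWb i ω, norm_nonneg (W i ω)]
    · refine (hU.integral_norm_sq_charFun_sub_le (s i) (hN i) (hn i)).trans ?_
      gcongr
      exact sub_le_self _ (by positivity)
  filter_upwards [hW, hbU] with ω hω1 hω2
  -- The bound `hbN` keeps `‖s i‖ * b (N i)` below `‖t‖ * B`, so the truncated norm controls the
  -- distance to `1`.
  have hV : Tendsto (fun i ↦ charFun (π (N i) ω) (s i)) atTop (𝓝 1) := by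
    have hlim := ((hω2.comp hNtop).const_mul (max (‖t‖ * B) 2))
    rw [mul_zero] at hlim
    rw [tendsto_iff_norm_sub_tendsto_zero]
    refine squeeze_zero' (.of_forall fun _ ↦ norm_nonneg _) ?_ hlim
    filter_upwards [hL.eventually_gt_atTop 0] with i hi
    have := hU.isProbabilityMeasure_composition (N i) ω
    refine (norm_charFun_sub_one_le_truncatedNorm _ (s i) (hb (N i))).trans ?_
    refine mul_le_mul_of_nonneg_right (max_le_max_right _ ?_)
      (integral_nonneg fun x ↦ by have := hb (N i); positivity)
    have hs : 0 < √(Real.log (n i)) := Real.sqrt_pos.2 hi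
    rw [norm_smul, norm_inv, Real.norm_of_nonneg hs.le]
    calc (√(Real.log (n i)))⁻¹ * ‖t‖ * b (N i)
        ≤ (√(Real.log (n i)))⁻¹ * ‖t‖ * (B * √(Real.log (n i))) := by
          gcongr
          exact hbN i
      _ = ‖t‖ * B := by field_simp
  have hcW : Tendsto (fun i ↦ c i * W i ω) atTop (𝓝 0) := by
    rw [tendsto_zero_iff_norm_tendsto_zero] at hω1 ⊢
    refine hω1.congr fun i ↦ ?_
    rw [norm_mul, norm_cexp_neg_I_mul, one_mul]
  have h := (hdet.mul hV).add hcW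
  rw [mul_one, add_zero] at h
  refine h.congr fun i ↦ ?_
  simp only [rescaledCharFun, W]
  ring

lemma measurable_rescaledCharFun (hU : IsReinforcedWalk P ℱ ν w π R) (m : E) (L : ℝ) (n : ℕ) :
    Measurable fun p : E × Ω ↦ rescaledCharFun m (π n p.2) L p.1 := by
  refine (stronglyMeasurable_uncurry_of_continuous_of_stronglyMeasurable
    (u := fun t ω ↦ rescaledCharFun m (π n ω) L t) (fun ω ↦ ?_) fun t ↦ ?_).measurable
  · have := hU.isProbabilityMeasure_composition n ω
    have hc : Continuous fun t ↦ charFun (π n ω) ((√L)⁻¹ • t) :=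
      Continuous.comp (g := charFun (π n ω)) (by fun_prop) (by fun_prop)
    exact Continuous.mul (by fun_prop) hc
  · exact ((hU.stronglyMeasurable_charFun_composition n _).mono (ℱ.le n)).const_mul _

lemma isProbabilityMeasure_map_rescale (hU : IsReinforcedWalk P ℱ ν w π R) (m : E) (L : ℝ) (n : ℕ)
    (ω : Ω) : IsProbabilityMeasure ((π n ω).map fun x ↦ (√L)⁻¹ • (x - L • m)) :=
  have := hU.isProbabilityMeasure_composition n ω
  Measure.isProbabilityMeasure_map (by fun_prop)

/-- Fubini yields, almost surely, convergence for almost every `t`; `tendsto_charFun_of_ae` then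
removes the exceptional `t`. -/
lemma ae_forall_tendsto_rescaledCharFun (hU : IsReinforcedWalk P ℱ ν w π R) {γ : Measure E}
    [IsProbabilityMeasure γ] (m : E) {n : ℕ → ℕ}
    (h : ∀ t, ∀ᵐ ω ∂P, Tendsto (fun i ↦ rescaledCharFun m (π (n i) ω) (Real.log (n i)) t) atTop
      (𝓝 (charFun γ t))) :
    ∀ᵐ ω ∂P, ∀ t, Tendsto (fun i ↦ rescaledCharFun m (π (n i) ω) (Real.log (n i)) t) atTop
      (𝓝 (charFun γ t)) := by
  have hae := (Measure.ae_ae_comm (μ := (Measure.addHaar : Measure E)) (ν := P)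
    (p := fun t ω ↦ Tendsto (fun i ↦ rescaledCharFun m (π (n i) ω) (Real.log (n i)) t) atTop
      (𝓝 (charFun γ t)))
    (measurableSet_tendsto_fun (fun i ↦ hU.measurable_rescaledCharFun m _ (n i))
      (measurable_charFun.comp measurable_fst))).1 (.of_forall h)
  filter_upwards [hae] with ω hω t
  have := fun i ↦ hU.isProbabilityMeasure_map_rescale m (Real.log (n i)) (n i) ω
  simp only [← charFun_map_smul_sub] at hω ⊢
  exact tendsto_charFun_of_ae Measure.addHaar hω t

/-- Each of the `n - k` steps moves mass at most `1 / k`, and hence the characteristic function by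
at most `2 / k`. -/
lemma ae_norm_charFun_sub_le (hU : IsReinforcedWalk P ℱ ν w π R) :
    ∀ᵐ ω ∂P, ∀ (k n : ℕ) (s : E), 0 < k → k ≤ n →
      ‖charFun (π n ω) s - charFun (π k ω) s‖ ≤ 2 * (n / k - 1) := by
  have hw := hU.weight_pos
  filter_upwards [ae_all_iff.2 fun n ↦ hU.integral_update (F := ℂ) n] with ω hω k n s hk hn
  have hk0 : (0 : ℝ) < k := by exact_mod_cast hk
  induction n, hn using Nat.le_induction with
  | base => simp [hk0.ne']
  | succ n hn ih =>
    have hkn : (k : ℝ) ≤ n := by exact_mod_cast hn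
    have h1 := hω n _ 1 (stronglyMeasurable_cexp_inner s) (norm_cexp_inner_le s)
    simp only [← charFun_apply] at h1
    have h2 : charFun (π (n + 1) ω) s - charFun (π n ω) s =
        ((1 / (w + n + 1) : ℝ) : ℂ) * (charFun (R n ω) s - charFun (π n ω) s) := by
      have h3 : (w + n) / (w + n + 1) = 1 - 1 / (w + n + 1) := by field_simp; ring
      rw [h1, h3, Complex.real_smul, Complex.real_smul]
      push_cast
      ring
    have h3 : ‖charFun (π (n + 1) ω) s - charFun (π n ω) s‖ ≤ 1 / k * 2 := by
      rw [h2, norm_mul, Complex.norm_of_nonneg (by positivity)]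
      gcongr
      · linarith
      · refine (norm_sub_le _ _).trans ?_
        linarith [hU.norm_charFun_reinforcement_le n ω s, hU.norm_charFun_composition_le n ω s]
    calc ‖charFun (π (n + 1) ω) s - charFun (π k ω) s‖
        = ‖(charFun (π (n + 1) ω) s - charFun (π n ω) s) +
            (charFun (π n ω) s - charFun (π k ω) s)‖ := by rw [sub_add_sub_cancel]
      _ ≤ 1 / k * 2 + 2 * (n / k - 1) := (norm_add_le _ _).trans (add_le_add h3 ih)
      _ = _ := by push_cast; ring

/-- Convergence along a sequence of times implies convergence along all times, if all large times
are approximated well enough by times of the sequence. -/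
lemma ae_tendsto_rescaledCharFun_of_subsequence (hU : IsReinforcedWalk P ℱ ν w π R) {γ : Measure E}
    [IsProbabilityMeasure γ] (m : E) {c j : ℕ → ℕ}
    (h : ∀ᵐ ω ∂P, ∀ t, Tendsto (fun i ↦ rescaledCharFun m (π (c i) ω) (Real.log (c i)) t) atTop
      (𝓝 (charFun γ t))) (hj : Tendsto j atTop atTop) (hc : ∀ i, 0 < c i)
    (hle : ∀ᶠ n in atTop, c (j n) ≤ n)
    (hratio : Tendsto (fun n : ℕ ↦ (n : ℝ) / c (j n)) atTop (𝓝 1)) :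
    ∀ᵐ ω ∂P, ∀ t, Tendsto (fun n : ℕ ↦ rescaledCharFun m (π n ω) (Real.log n) t) atTop
      (𝓝 (charFun γ t)) := by
  set L : ℕ → ℝ := fun n ↦ Real.log n
  set L' : ℕ → ℝ := fun n ↦ Real.log (c (j n))
  have hLtop : Tendsto L atTop atTop := Real.tendsto_log_atTop.comp tendsto_natCast_atTop_atTop
  have hdiff : Tendsto (fun n ↦ L n - L' n) atTop (𝓝 0) := by
    have h1 := (Real.continuousAt_log one_ne_zero).tendsto.comp hratio
    rw [Real.log_one] at h1
    refine h1.congr' ?_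
    filter_upwards [eventually_gt_atTop 0] with n hn
    exact Real.log_div (by exact_mod_cast hn.ne') (by exact_mod_cast (hc _).ne')
  have hsq : Tendsto (fun n ↦ √(L n)) atTop atTop := Real.tendsto_sqrt_atTop.comp hLtop
  have hLL : Tendsto (fun n ↦ L' n / L n) atTop (𝓝 1) := by
    have h1 := (hdiff.div_atTop hLtop).const_sub 1
    rw [sub_zero] at h1
    refine h1.congr' ?_
    filter_upwards [hLtop.eventually_gt_atTop 0] with n hn
    field_simp
    ring
  have hr : Tendsto (fun n ↦ √(L' n) / √(L n)) atTop (𝓝 1) := by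
    have h1 := hLL.sqrt
    rw [Real.sqrt_one] at h1
    refine h1.congr' ?_
    filter_upwards [hLtop.eventually_gt_atTop 0] with n hn
    exact Real.sqrt_div' _ hn.le
  have hL'top : Tendsto L' atTop atTop := by
    have := hLtop.atTop_add hdiff.neg
    refine this.congr fun n ↦ ?_
    ring
  filter_upwards [h, hU.ae_norm_charFun_sub_le] with ω hω1 hω2 t
  -- The factor `√(L' n) / √(L n)` makes both compositions be evaluated at the same frequency `t /
  -- √(L n)`.
  have hmain : Tendsto (fun n ↦ rescaledCharFun m (π (c (j n)) ω) (L' n)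
      ((√(L' n) / √(L n)) • t)) atTop (𝓝 (charFun γ t)) := by
    have := fun i ↦ hU.isProbabilityMeasure_map_rescale m (Real.log (c i)) (c i) ω
    simp only [← charFun_map_smul_sub] at hω1
    have h1 := tendsto_charFun_comp_of_tendsto hω1 hj (s := fun n ↦ (√(L' n) / √(L n)) • t)
      (t := t) (by simpa using hr.smul_const t)
    simpa only [charFun_map_smul_sub] using h1
  have herr : Tendsto (fun n : ℕ ↦ |⟪m, t⟫_ℝ| * (|L n - L' n| / √(L n)) +
      2 * ((n : ℝ) / c (j n) - 1)) atTop (𝓝 0) := by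
    have h1 := (hdiff.abs.div_atTop (by simpa using hsq)).const_mul |⟪m, t⟫_ℝ|
    have h2 := (hratio.sub_const 1).const_mul 2
    simpa using h1.add h2
  -- What remains is a phase difference of order `|L n - L' n| / √(L n)` and the change of the
  -- composition itself.
  have hd : Tendsto (fun n ↦ rescaledCharFun m (π n ω) (L n) t - rescaledCharFun m (π (c (j n)) ω)
      (L' n) ((√(L' n) / √(L n)) • t)) atTop (𝓝 0) := by
    refine squeeze_zero_norm' ?_ herr
    filter_upwards [hLtop.eventually_gt_atTop 0, hL'top.eventually_gt_atTop 0, hle]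
      with n hn hn' hcn
    have hs : 0 < √(L n) := Real.sqrt_pos.2 hn
    have hs' : 0 < √(L' n) := Real.sqrt_pos.2 hn'
    set x := ⟪m, t⟫_ℝ * √(L n)
    set y := ⟪m, (√(L' n) / √(L n)) • t⟫_ℝ * √(L' n)
    have harg : (√(L' n))⁻¹ • (√(L' n) / √(L n)) • t = (√(L n))⁻¹ • t := by
      rw [smul_smul]
      congr 1
      field_simp
    have hxy : |y - x| = |⟪m, t⟫_ℝ| * (|L n - L' n| / √(L n)) := by
      have : y - x = -(⟪m, t⟫_ℝ * ((L n - L' n) / √(L n))) := by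
        simp only [x, y, inner_smul_right]
        field_simp
        rw [Real.sq_sqrt hn.le, Real.sq_sqrt hn'.le]
        ring
      rw [this, abs_neg, abs_mul, abs_div, abs_of_pos hs]
    have hphase : ‖Complex.exp (-(Complex.I * x)) - Complex.exp (-(Complex.I * y))‖ ≤ |y - x| := by
      have : Complex.exp (-(Complex.I * x)) - Complex.exp (-(Complex.I * y)) =
          Complex.exp (-(Complex.I * y)) * (Complex.exp ((y - x : ℝ) * Complex.I) - 1) := by
        rw [mul_sub, ← Complex.exp_add, mul_one]
        congr 2
        push_cast
        ring
      rw [this, norm_mul, norm_cexp_neg_I_mul, one_mul]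
      exact norm_cexp_sub_one_le _
    set V := charFun (π n ω) ((√(L n))⁻¹ • t)
    set V' := charFun (π (c (j n)) ω) ((√(L n))⁻¹ • t)
    have hV : ‖V - V'‖ ≤ 2 * ((n : ℝ) / c (j n) - 1) := hω2 _ _ _ (hc _) hcn
    have hV1 : ‖V'‖ ≤ 1 := hU.norm_charFun_composition_le _ ω _
    calc ‖rescaledCharFun m (π n ω) (L n) t - rescaledCharFun m (π (c (j n)) ω) (L' n)
          ((√(L' n) / √(L n)) • t)‖
        = ‖(Complex.exp (-(Complex.I * x)) - Complex.exp (-(Complex.I * y))) * V' +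
            Complex.exp (-(Complex.I * x)) * (V - V')‖ := by
          simp only [rescaledCharFun]
          rw [harg]
          congr 1
          ring
      _ ≤ |y - x| * 1 + 1 * (2 * ((n : ℝ) / c (j n) - 1)) := by
          refine (norm_add_le _ _).trans (add_le_add ?_ ?_)
          · rw [norm_mul]
            gcongr
          · rw [norm_mul, norm_cexp_neg_I_mul]
            gcongr
      _ = _ := by rw [hxy, mul_one, one_mul]
  simpa using hd.add hmain

end IsReinforcedWalk

/-! ### Choice of times and scales -/

/-- Times of subexponential growth, whose consecutive quotients tend to `1`. -/
noncomputable def sparseTime (i : ℕ) : ℕ := ⌈Real.exp √i⌉₊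

lemma sparseTime_pos (i : ℕ) : 0 < sparseTime i := Nat.ceil_pos.2 (Real.exp_pos _)

lemma sqrt_le_log_sparseTime (i : ℕ) : √(i : ℝ) ≤ Real.log (sparseTime i) :=
  (Real.le_log_iff_exp_le (by exact_mod_cast sparseTime_pos i)).2 (Nat.le_ceil _)

lemma rpow_le_sqrt_log_sparseTime (i : ℕ) :
    (i : ℝ) ^ (1 / 4 : ℝ) ≤ √(Real.log (sparseTime i)) := by
  refine Eq.trans_le ?_ (Real.sqrt_le_sqrt (sqrt_le_log_sparseTime i))
  rw [Real.sqrt_eq_rpow, Real.sqrt_eq_rpow, ← Real.rpow_mul (by positivity)]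
  norm_num

lemma tendsto_log_sparseTime : Tendsto (fun i ↦ Real.log (sparseTime i)) atTop atTop :=
  tendsto_atTop_mono sqrt_le_log_sparseTime
    (Real.tendsto_sqrt_atTop.comp tendsto_natCast_atTop_atTop)

lemma eventually_sq_le_sparseTime : ∀ᶠ i : ℕ in atTop, i ^ 2 ≤ sparseTime i := by
  have h := (Real.tendsto_pow_mul_exp_neg_atTop_nhds_zero 4).comp
    (Real.tendsto_sqrt_atTop.comp tendsto_natCast_atTop_atTop)
  filter_upwards [h.eventually_lt_const zero_lt_one] with i hi
  simp only [Function.comp_apply] at hi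
  have h1 : √(i : ℝ) ^ 4 = (i : ℝ) ^ 2 := by
    rw [show √(i : ℝ) ^ 4 = (√(i : ℝ) ^ 2) ^ 2 by ring, Real.sq_sqrt (by positivity)]
  rw [h1, Real.exp_neg, ← div_eq_mul_inv, div_lt_one (Real.exp_pos _)] at hi
  have h2 := hi.le.trans (Nat.le_ceil (Real.exp √i))
  exact_mod_cast h2

lemma tendsto_log_sq_add_div_sqrt_log_sparseTime {w : ℝ} (hw : 0 < w) :
    Tendsto (fun i : ℕ ↦ Real.log ((i ^ 2 : ℕ) + w + 1) / √(Real.log (sparseTime i)))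
      atTop (𝓝 0) := by
  have hpow : Tendsto (fun i : ℕ ↦ (i : ℝ) ^ (1 / 4 : ℝ)) atTop atTop :=
    (tendsto_rpow_atTop (by norm_num)).comp tendsto_natCast_atTop_atTop
  have h1 : Tendsto (fun i : ℕ ↦ Real.log i / (i : ℝ) ^ (1 / 4 : ℝ)) atTop (𝓝 0) :=
    (isLittleO_log_rpow_atTop (by norm_num : (0 : ℝ) < 1 / 4)).tendsto_div_nhds_zero.comp
      tendsto_natCast_atTop_atTop
  have h2 := (hpow.const_div_atTop (Real.log (w + 2))).add (h1.const_mul 2)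
  rw [mul_zero, add_zero] at h2
  refine squeeze_zero' ?_ ?_ h2
  · refine .of_forall fun i ↦ div_nonneg (Real.log_nonneg ?_) (Real.sqrt_nonneg _)
    have : (0 : ℝ) ≤ (i ^ 2 : ℕ) := by positivity
    linarith
  · filter_upwards [eventually_gt_atTop 0] with i hi
    have hi1 : (1 : ℝ) ≤ i := by exact_mod_cast hi
    have hi2 : (1 : ℝ) ≤ (i : ℝ) ^ 2 := one_le_pow₀ hi1
    have h3 : Real.log ((i ^ 2 : ℕ) + w + 1) ≤ Real.log (w + 2) + 2 * Real.log i := by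
      rw [← Nat.cast_ofNat (R := ℝ) (n := 2), ← Real.log_pow, ← Real.log_mul (by positivity)
        (by positivity)]
      refine Real.log_le_log (by positivity) ?_
      push_cast
      nlinarith
    have h4 : 0 ≤ Real.log (w + 2) + 2 * Real.log i :=
      add_nonneg (Real.log_nonneg (by linarith)) (mul_nonneg zero_le_two (Real.log_nonneg hi1))
    calc _ ≤ (Real.log (w + 2) + 2 * Real.log i) / (i : ℝ) ^ (1 / 4 : ℝ) := by
          gcongr
          exact rpow_le_sqrt_log_sparseTime i
      _ = _ := by ring

/-- The index of a time of the sequence `sparseTime` that is close to `n`. -/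
noncomputable def sparseIndex (n : ℕ) : ℕ := ⌊Real.log n ^ 2⌋₊

lemma tendsto_log_natCast_atTop : Tendsto (fun n : ℕ ↦ Real.log n) atTop atTop :=
  Real.tendsto_log_atTop.comp tendsto_natCast_atTop_atTop

lemma tendsto_sparseIndex : Tendsto sparseIndex atTop atTop :=
  tendsto_nat_floor_atTop.comp ((tendsto_pow_atTop two_ne_zero).comp tendsto_log_natCast_atTop)

lemma sparseTime_sparseIndex_le {n : ℕ} (hn : 0 < n) : sparseTime (sparseIndex n) ≤ n := by
  have hn1 : (1 : ℝ) ≤ n := by exact_mod_cast hn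
  have hL : 0 ≤ Real.log n := Real.log_nonneg hn1
  rw [sparseTime, Nat.ceil_le, ← Real.le_log_iff_exp_le (by positivity)]
  refine Real.sqrt_le_iff.2 ⟨hL, Nat.floor_le (by positivity)⟩

lemma tendsto_div_sparseTime_sparseIndex :
    Tendsto (fun n : ℕ ↦ (n : ℝ) / sparseTime (sparseIndex n)) atTop (𝓝 1) := by
  have h1 : Tendsto (fun n : ℕ ↦ Real.exp (1 / Real.log n)) atTop (𝓝 1) := by
    have := (Real.continuous_exp.tendsto 0).comp (tendsto_log_natCast_atTop.const_div_atTop 1)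
    simpa [Function.comp_def] using this
  refine tendsto_of_tendsto_of_tendsto_of_le_of_le' tendsto_const_nhds h1 ?_ ?_
  · filter_upwards [eventually_gt_atTop 0] with n hn
    rw [one_le_div (by exact_mod_cast sparseTime_pos _)]
    exact_mod_cast sparseTime_sparseIndex_le hn
  · filter_upwards [eventually_gt_atTop 0, tendsto_log_natCast_atTop.eventually_ge_atTop 1]
      with n hn hL
    have hn0 : (0 : ℝ) < n := by exact_mod_cast hn
    set L := Real.log n
    -- For `L ≥ 1`, `(L - 1 / L) ^ 2 = L ^ 2 - 2 + 1 / L ^ 2 ≤ L ^ 2 - 1 ≤ ⌊L ^ 2⌋`.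
    have h2 : L - 1 / L ≤ √(sparseIndex n : ℝ) := by
      refine Real.le_sqrt_of_sq_le ?_
      have h3 := (Nat.lt_floor_add_one (L ^ 2)).le
      have h4 : (L - 1 / L) ^ 2 = L ^ 2 - 2 + (1 / L) ^ 2 := by field_simp; ring
      have h5 : (1 / L) ^ 2 ≤ 1 := by
        refine pow_le_one₀ (by positivity) ?_
        rwa [div_le_one (by positivity)]
      rw [h4, sparseIndex]
      linarith
    calc (n : ℝ) / sparseTime (sparseIndex n) ≤ n / Real.exp √(sparseIndex n : ℝ) := by
          gcongr
          exact Nat.le_ceil _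
      _ = Real.exp (L - √(sparseIndex n : ℝ)) := by rw [Real.exp_sub, Real.exp_log hn0]
      _ ≤ _ := Real.exp_le_exp.2 (by linarith)

/-- A scale that dominates the spread of the composition of the urn. -/
noncomputable def spreadBound (n : ℕ) : ℝ := ((n : ℝ) + 1) ^ (1 / 8 : ℝ)

lemma spreadBound_pos (n : ℕ) : 0 < spreadBound n := by unfold spreadBound; positivity

lemma monotone_spreadBound : Monotone spreadBound := fun m n h ↦ by
  unfold spreadBound
  gcongr

lemma tendsto_spreadBound : Tendsto spreadBound atTop atTop :=
  (tendsto_rpow_atTop (by norm_num)).comp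
    (tendsto_atTop_add_const_right _ _ tendsto_natCast_atTop_atTop)

lemma summable_one_div_mul_spreadBound :
    Summable fun n : ℕ ↦ 1 / (((n : ℝ) + 1) * spreadBound n) := by
  have h := (summable_nat_add_iff 1).2
    (Real.summable_one_div_nat_rpow.2 (by norm_num : (1 : ℝ) < 1 + 1 / 8))
  refine h.congr fun n ↦ ?_
  rw [spreadBound, Nat.cast_add, Nat.cast_one, Real.rpow_add (by positivity), Real.rpow_one]

lemma tendsto_harmonic_div_spreadBound :
    Tendsto (fun n ↦ (∑ k ∈ Finset.range n, 1 / ((k : ℝ) + 1)) / spreadBound n) atTop (𝓝 0) := by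
  have h1 : Tendsto (fun n : ℕ ↦ Real.log ((n : ℝ) + 1) / spreadBound n) atTop (𝓝 0) :=
    (isLittleO_log_rpow_atTop (by norm_num : (0 : ℝ) < 1 / 8)).tendsto_div_nhds_zero.comp
      (tendsto_atTop_add_const_right _ _ tendsto_natCast_atTop_atTop)
  have h2 := (tendsto_spreadBound.const_div_atTop 1).add h1
  rw [add_zero] at h2
  refine squeeze_zero (fun n ↦ ?_) (fun n ↦ ?_) h2
  · have := spreadBound_pos n
    positivity
  · rw [← add_div]
    refine div_le_div_of_nonneg_right ?_ (spreadBound_pos n).le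
    have h3 := harmonic_le_one_add_log n
    have h4 : ((harmonic n : ℚ) : ℝ) = ∑ k ∈ Finset.range n, 1 / ((k : ℝ) + 1) := by
      simp [harmonic]
    rw [← h4]
    refine h3.trans ?_
    rcases Nat.eq_zero_or_pos n with rfl | hn
    · simp
    · gcongr
      linarith

/-- This fixes the exponent `1 / 8`: at time `i ^ 2` it gives the order `i ^ (1 / 4)`, a lower bound
for `√(log (sparseTime i))`. Summability and the harmonic estimate only need a positive exponent. -/
lemma spreadBound_sq_le {i : ℕ} (hi : 0 < i) :
    spreadBound (i ^ 2) ≤ 2 * √(Real.log (sparseTime i)) := by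
  have hi1 : (1 : ℝ) ≤ i := by exact_mod_cast hi
  calc spreadBound (i ^ 2) ≤ (2 * (i : ℝ) ^ 2) ^ (1 / 8 : ℝ) := by
        unfold spreadBound
        push_cast
        gcongr
        nlinarith
    _ = (2 : ℝ) ^ (1 / 8 : ℝ) * (i : ℝ) ^ (1 / 4 : ℝ) := by
        rw [Real.mul_rpow (by positivity) (by positivity), ← Real.rpow_natCast,
          ← Real.rpow_mul (by positivity)]
        norm_num
    _ ≤ 2 * √(Real.log (sparseTime i)) := by
        gcongr
        · exact Real.rpow_le_self_of_one_le one_le_two (by norm_num)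
        · exact rpow_le_sqrt_log_sparseTime i

/-! ### Limit theorem for reinforced walks -/

namespace IsReinforcedWalk

variable {E Ω : Type*} [NormedAddCommGroup E] [InnerProductSpace ℝ E] [FiniteDimensional ℝ E]
  [MeasurableSpace E] [BorelSpace E] {mΩ : MeasurableSpace Ω} {P : Measure Ω}
  [IsProbabilityMeasure P] {ℱ : Filtration ℕ mΩ} {ν : Measure E} [IsProbabilityMeasure ν] {w : ℝ}
  {π R : ℕ → Ω → Measure E}

theorem ae_tendsto_rescaledCharFun (hU : IsReinforcedWalk P ℱ ν w π R)
    (hν : MemLp (fun x : E ↦ x) 2 ν) {γ : Measure E} [IsProbabilityMeasure γ]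
    (hγ : ∀ t, charFun γ t = Complex.exp (-(∫ x, ⟪x, t⟫_ℝ ^ 2 ∂ν : ℝ) / 2)) :
    ∀ᵐ ω ∂P, ∀ t, Tendsto (fun n : ℕ ↦ rescaledCharFun (∫ x, x ∂ν) (π n ω) (Real.log n) t) atTop
      (𝓝 (charFun γ t)) := by
  -- The inequality `i ^ 2 ≤ sparseTime i` is only known for large `i`, so the sequences are shifted
  -- by `K`.
  obtain ⟨K, hK⟩ := eventually_atTop.1 (eventually_sq_le_sparseTime.and (eventually_gt_atTop 0))
  have hshift : Tendsto (fun i ↦ i + K) atTop atTop := tendsto_add_atTop_nat K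
  have hpos (i : ℕ) : 0 < i + K := (hK _ (Nat.le_add_left K i)).2
  have hspread := hU.ae_tendsto_integral_truncatedNorm (hν.integrable one_le_two).norm
    spreadBound_pos monotone_spreadBound tendsto_spreadBound summable_one_div_mul_spreadBound
    tendsto_harmonic_div_spreadBound
  have hsub := hU.ae_forall_tendsto_rescaledCharFun (γ := γ) (∫ x, x ∂ν)
    (n := fun i ↦ sparseTime (i + K)) fun t ↦ by
      rw [hγ]
      refine hU.ae_tendsto_rescaledCharFun_of_sparse hν (N := fun i ↦ (i + K) ^ 2)
        (fun i ↦ pow_pos (hpos i) 2) (fun i ↦ (hK _ (Nat.le_add_left K i)).1)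
        ((tendsto_pow_atTop two_ne_zero).comp hshift) (tendsto_log_sparseTime.comp hshift)
        ((tendsto_log_sq_add_div_sqrt_log_sparseTime hU.weight_pos).comp hshift) ?_
        spreadBound_pos hspread (fun i ↦ spreadBound_sq_le (hpos i)) t
      have h := (summable_nat_add_iff K).2 (Real.summable_one_div_nat_pow.2 one_lt_two)
      exact h.congr fun i ↦ by push_cast; rfl
  refine hU.ae_tendsto_rescaledCharFun_of_subsequence _ (c := sparseTime) ?_ tendsto_sparseIndex
    sparseTime_pos ?_ tendsto_div_sparseTime_sparseIndex
  · filter_upwards [hsub] with ω hω t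
    exact (tendsto_add_atTop_iff_nat K).1 (hω t)
  · filter_upwards [eventually_gt_atTop 0] with n hn using sparseTime_sparseIndex_le hn

end IsReinforcedWalk

/-! ### The two urns as reinforced walks -/

lemma measurable_normalize {S : Type*} [MeasurableSpace S] [Nonempty S] :
    Measurable fun μ : FiniteMeasure S ↦ (μ.normalize : Measure S) := by
  refine Measure.measurable_of_measurable_coe _ fun s hs ↦ ?_
  have hcoe (t : Set S) (ht : MeasurableSet t) :
      Measurable fun μ : FiniteMeasure S ↦ (μ : Measure S) t :=
    (Measure.measurable_coe ht).comp measurable_subtype_coe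
  have hmass : Measurable fun μ : FiniteMeasure S ↦ μ.mass :=
    (hcoe Set.univ .univ).ennreal_toNNReal
  -- The zero measure is normalized to a Dirac mass at an arbitrary point, hence the case
  -- distinction.
  have heq : (fun μ : FiniteMeasure S ↦ (μ.normalize : Measure S) s) =
      fun μ : FiniteMeasure S ↦
      if μ.mass = 0 then (Measure.dirac ‹Nonempty S›.some : Measure S) s
      else ((μ.mass⁻¹ : NNReal) : ENNReal) * (μ : Measure S) s := by
    ext μ
    by_cases h : μ.mass = 0
    · have h' : μ.normalize =
          ⟨Measure.dirac ‹Nonempty S›.some, Measure.dirac.isProbabilityMeasure⟩ := dif_pos h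
      rw [if_pos h, h']
      rfl
    · rw [if_neg h, μ.toMeasure_normalize_eq_of_nonzero (μ.mass_nonzero_iff.1 h)]
      rfl
  rw [heq]
  exact Measurable.ite (hmass (measurableSet_singleton 0)) measurable_const
    (hmass.inv.coe_nnreal_ennreal.mul (hcoe s hs))

namespace IsPolyaUrn

section

variable {S Ω : Type*} [MeasurableSpace S] [Nonempty S] {mΩ : MeasurableSpace Ω}
  {P : Measure Ω} {ℱ : Filtration ℕ mΩ} {μ₀ : FiniteMeasure S}
  {μ : ℕ → Ω → FiniteMeasure S} {X : ℕ → Ω → S} {R : ℕ → Ω → FiniteMeasure S}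

lemma mass_composition (hU : IsPolyaUrn P ℱ μ₀ μ X R) (hR : ∀ n ω, (R n ω).mass = 1) (n : ℕ) :
    ∀ᵐ ω ∂P, (μ n ω).mass = μ₀.mass + n := by
  induction n with
  | zero => filter_upwards [hU.initial] with ω hω; simp [hω]
  | succ n ih =>
    filter_upwards [ih, hU.update n] with ω h1 h2
    have h3 : (μ n ω + R n ω).mass = (μ n ω).mass + (R n ω).mass := by
      change (μ n ω + R n ω) Set.univ = _
      rw [FiniteMeasure.coeFn_add]
      rfl
    rw [h2, h3, h1, hR]
    push_cast
    ring

lemma normalize_update (hU : IsPolyaUrn P ℱ μ₀ μ X R) (hμ₀ : μ₀ ≠ 0)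
    (hR : ∀ n ω, (R n ω).mass = 1) (n : ℕ) :
    ∀ᵐ ω ∂P, ((μ (n + 1) ω).normalize : Measure S) =
      ENNReal.ofReal (((μ₀.mass : ℝ) + n) / (μ₀.mass + n + 1)) • ((μ n ω).normalize : Measure S) +
        ENNReal.ofReal (1 / ((μ₀.mass : ℝ) + n + 1)) • (R n ω : Measure S) := by
  have hm : 0 < μ₀.mass := pos_iff_ne_zero.2 (μ₀.mass_nonzero_iff.2 hμ₀)
  filter_upwards [hU.mass_composition hR n, hU.mass_composition hR (n + 1), hU.update n]
    with ω h1 h2 h3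
  have hne (k : ℕ) (hk : (μ k ω).mass = μ₀.mass + k) : μ k ω ≠ 0 := by
    rw [← FiniteMeasure.mass_nonzero_iff, hk]
    positivity
  rw [(μ (n + 1) ω).toMeasure_normalize_eq_of_nonzero (hne _ h2),
    (μ n ω).toMeasure_normalize_eq_of_nonzero (hne _ h1), h1, h2, h3, FiniteMeasure.toMeasure_add,
    smul_add]
  have e1 : ENNReal.ofReal (1 / ((μ₀.mass : ℝ) + n + 1)) =
      (((μ₀.mass + (n + 1 : ℕ))⁻¹ : NNReal) : ENNReal) := by
    rw [ENNReal.ofReal, ENNReal.coe_inj, ← NNReal.coe_inj, Real.coe_toNNReal _ (by positivity)]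
    push_cast
    rw [one_div, add_assoc]
  have e2 : ENNReal.ofReal (((μ₀.mass : ℝ) + n) / (μ₀.mass + n + 1)) =
      (((μ₀.mass + (n + 1 : ℕ))⁻¹ * (μ₀.mass + n) : NNReal) : ENNReal) := by
    rw [ENNReal.ofReal, ENNReal.coe_inj, ← NNReal.coe_inj, Real.coe_toNNReal _ (by positivity)]
    push_cast
    rw [div_eq_mul_inv, mul_comm, add_assoc]
  have h4 : (μ₀.mass + n : NNReal) ≠ 0 := by positivity
  rw [e1, e2]
  congr 1
  rw [ENNReal.coe_mul, mul_smul]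
  change _ = ((μ₀.mass + (n + 1 : ℕ))⁻¹ : NNReal) • ((μ₀.mass + n : NNReal) •
    ((μ₀.mass + n : NNReal)⁻¹ • (μ n ω : Measure S)))
  rw [smul_inv_smul₀ h4]

/-- The conditional law of the draw, given set by set in `draw`, becomes an identity of measures on
every past event. -/
lemma map_draw (hU : IsPolyaUrn P ℱ μ₀ μ X R) [IsFiniteMeasure P] (n : ℕ) {A : Set Ω}
    (hA : MeasurableSet[ℱ n] A) :
    (P.restrict A).map (X n) =
      (P.restrict A).bind fun ω ↦ ((μ n ω).normalize : Measure S) := by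
  have hX : Measurable (X n) := (hU.measurable_draw n).mono (ℱ.le _) le_rfl
  have hπ : Measurable fun ω ↦ ((μ n ω).normalize : Measure S) :=
    measurable_normalize.comp ((hU.measurable_composition n).mono (ℱ.le n) le_rfl)
  ext B hB
  rw [Measure.map_apply hX hB, Measure.bind_apply hB hπ.aemeasurable,
    Measure.restrict_apply (hX hB)]
  have h1 : P.real (X n ⁻¹' B ∩ A) = ∫ ω in A, ((μ n ω).normalize : Measure S).real B ∂P := by
    have h2 := setIntegral_condExp (ℱ.le n)
      ((integrable_const (1 : ℝ)).indicator (hX hB) (μ := P)) hA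
    rw [← setIntegral_congr_ae (g := fun ω ↦ ((μ n ω).normalize : Measure S).real B) (ℱ.le n _ hA)
      ((hU.draw n B hB).mono fun ω h _ ↦ h), h2, setIntegral_indicator (hX hB)]
    simp [Set.inter_comm]
  rw [← ENNReal.ofReal_toReal (measure_ne_top P (X n ⁻¹' B ∩ A))]
  rw [show (P (X n ⁻¹' B ∩ A)).toReal = P.real (X n ⁻¹' B ∩ A) from rfl, h1,
    ofReal_integral_eq_lintegral_ofReal]
  · congr 1 with ω
    exact ENNReal.ofReal_toReal (measure_ne_top _ _)
  · refine Integrable.of_bound (Measurable.aestronglyMeasurable ?_) 1 (.of_forall fun ω ↦ ?_)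
    · exact ((Measure.measurable_coe hB).comp hπ).ennreal_toReal
    · rw [Real.norm_of_nonneg measureReal_nonneg]
      exact measureReal_le_one
  · exact .of_forall fun _ ↦ measureReal_nonneg

end

section

variable {E Ω : Type*} [NormedAddCommGroup E] [InnerProductSpace ℝ E] [FiniteDimensional ℝ E]
  [MeasurableSpace E] [BorelSpace E] {mΩ : MeasurableSpace Ω} {P : Measure Ω}
  [IsProbabilityMeasure P] {ℱ : Filtration ℕ mΩ} {ν : Measure E} [IsProbabilityMeasure ν]
  {μ₀ : FiniteMeasure E} {μ : ℕ → Ω → FiniteMeasure E} {X : ℕ → Ω → E}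
  {R : ℕ → Ω → FiniteMeasure E}

lemma isReinforcedWalk (hU : IsPolyaUrn P ℱ μ₀ μ X R) (hμ₀ : μ₀ ≠ 0)
    (hprob : ∀ n ω, IsProbabilityMeasure (R n ω : Measure E))
    (hR : ∀ n, Measurable fun ω ↦ (R n ω : Measure E))
    (hbind : ∀ n A, MeasurableSet[ℱ n] A →
      (P.restrict A).bind (fun ω ↦ (R n ω : Measure E)) = ((P.restrict A).map (X n)) ∗ ν) :
    IsReinforcedWalk P ℱ ν μ₀.mass (fun n ω ↦ ((μ n ω).normalize : Measure E))
      fun n ω ↦ (R n ω : Measure E) where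
  weight_pos := by
    exact_mod_cast pos_iff_ne_zero.2 (μ₀.mass_nonzero_iff.2 hμ₀)
  measurable_composition n := measurable_normalize.comp (hU.measurable_composition n)
  measurable_reinforcement := hR
  isProbabilityMeasure_composition n ω := inferInstance
  isProbabilityMeasure_reinforcement := hprob
  update := hU.normalize_update hμ₀ fun n ω ↦ by
    have := hprob n ω
    rw [← ENNReal.coe_inj, FiniteMeasure.ennreal_mass, measure_univ, ENNReal.coe_one]
  bind_reinforcement n A hA := by rw [hbind n A hA, hU.map_draw n hA]

end

end IsPolyaUrn

section Convolution

variable {E : Type*} [NormedAddCommGroup E] [InnerProductSpace ℝ E] [FiniteDimensional ℝ E]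
  [MeasurableSpace E] [BorelSpace E] {ν : Measure E} [IsProbabilityMeasure ν]

lemma measurable_map_const_add : Measurable fun x : E ↦ ν.map (x + ·) := by
  refine Measure.measurable_of_measurable_coe _ fun s hs ↦ ?_
  have : (fun x : E ↦ ν.map (x + ·) s) = fun x ↦ ν (Prod.mk x ⁻¹' ((fun p ↦ p.1 + p.2) ⁻¹' s)) := by
    ext x
    rw [Measure.map_apply (by fun_prop) hs]
    rfl
  rw [this]
  exact measurable_measure_prodMk_left (measurable_add hs)

lemma bind_map_const_add (m : Measure E) [SFinite m] :
    m.bind (fun x ↦ ν.map (x + ·)) = m ∗ ν := by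
  ext s hs
  rw [Measure.bind_apply hs measurable_map_const_add.aemeasurable, Measure.conv,
    Measure.map_apply measurable_add hs, Measure.prod_apply (measurable_add hs)]
  congr 1 with x
  rw [Measure.map_apply (by fun_prop) hs]
  rfl

end Convolution

section Urns

variable {d : ℕ} {Ω : Type*} {mΩ : MeasurableSpace Ω} {P : Measure Ω} [IsProbabilityMeasure P]
  {ℱ : Filtration ℕ mΩ} {ν : Measure (EuclideanSpace ℝ (Fin d))} [IsProbabilityMeasure ν]
  {μ₀ : FiniteMeasure (EuclideanSpace ℝ (Fin d))}
  {μ : ℕ → Ω → FiniteMeasure (EuclideanSpace ℝ (Fin d))}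
  {X η : ℕ → Ω → EuclideanSpace ℝ (Fin d)}

lemma IsDRWPolyaUrn.isReinforcedWalk (hU : IsDRWPolyaUrn P ℱ ν μ₀ μ X) (hμ₀ : μ₀ ≠ 0) :
    IsReinforcedWalk P ℱ ν μ₀.mass
      (fun n ω ↦ ((μ n ω).normalize : Measure (EuclideanSpace ℝ (Fin d))))
      fun n ω ↦ ν.map (X n ω + ·) := by
  have hX (n) : Measurable (X n) := (hU.measurable_draw n).mono (ℱ.le _) le_rfl
  refine IsPolyaUrn.isReinforcedWalk hU hμ₀
    (fun n ω ↦ Measure.isProbabilityMeasure_map (by fun_prop))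
    (fun n ↦ measurable_map_const_add.comp (hX n)) fun n A _ ↦ ?_
  rw [← bind_map_const_add]
  change (P.restrict A).bind (fun ω ↦ ν.map (X n ω + ·)) = _
  ext s hs
  have hm := measurable_map_const_add (ν := ν)
  have hm' {s} (hs : MeasurableSet s) : Measurable fun x ↦ ν.map (x + ·) s :=
    (Measure.measurable_coe hs).comp hm
  have hmX : Measurable fun ω ↦ ν.map (X n ω + ·) := hm.comp (hX n)
  rw [Measure.bind_apply hs hmX.aemeasurable, Measure.bind_apply hs hm.aemeasurable,
    lintegral_map (hm' hs) (hX n)]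

lemma IsSRWPolyaUrn.isReinforcedWalk (hU : IsSRWPolyaUrn P ℱ ν μ₀ μ X η) (hμ₀ : μ₀ ≠ 0) :
    IsReinforcedWalk P ℱ ν μ₀.mass
      (fun n ω ↦ ((μ n ω).normalize : Measure (EuclideanSpace ℝ (Fin d))))
      fun n ω ↦ Measure.dirac (X n ω + η n ω) := by
  have hX (n) : Measurable (X n) := (hU.isPolyaUrn.measurable_draw n).mono (ℱ.le _) le_rfl
  have hη (n) : Measurable (η n) := (hU.measurable_offset n).mono (ℱ.le _) le_rfl
  refine IsPolyaUrn.isReinforcedWalk hU.isPolyaUrn hμ₀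
    (fun n ω ↦ Measure.dirac.isProbabilityMeasure)
    (fun n ↦ Measure.measurable_dirac.comp ((hX n).add (hη n))) fun n A hA ↦ ?_
  change (P.restrict A).bind (fun ω ↦ Measure.dirac (X n ω + η n ω)) = _
  -- Joint independence of `η n` from `X n` and the history is needed here: it keeps the product
  -- form after restriction to the past event `A`.
  have hprod : ((P.restrict A).map (X n)).prod ν =
      (P.restrict A).map fun ω ↦ (X n ω, η n ω) := by
    refine Measure.prod_eq fun s t hs ht ↦ ?_
    rw [Measure.map_apply ((hX n).prodMk (hη n)) (hs.prod ht), Measure.map_apply (hX n) hs,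
      Measure.restrict_apply (((hX n).prodMk (hη n)) (hs.prod ht)),
      Measure.restrict_apply (hX n hs),
      ← hU.offset_law n, Measure.map_apply (hη n) ht]
    have hind := (Indep_iff _ _ P).1 (hU.offset_indep n) (η n ⁻¹' t) (X n ⁻¹' s ∩ A) ⟨t, ht, rfl⟩
      (MeasurableSet.inter (le_sup_right (a := (ℱ n : MeasurableSpace Ω)) _ ⟨s, hs, rfl⟩)
        (le_sup_left (b := MeasurableSpace.comap (X n) inferInstance) _ hA))
    rw [mul_comm, ← hind]
    congr 1
    ext ω
    simp only [Set.mem_inter_iff, Set.mem_preimage, Set.mem_prod]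
    tauto
  have hadd : Measurable fun ω ↦ X n ω + η n ω := (hX n).add (hη n)
  rw [Measure.bind_dirac_eq_map _ hadd, Measure.conv, hprod,
    Measure.map_map measurable_add ((hX n).prodMk (hη n))]
  rfl

end Urns

/-! ### The limiting normal law and the conclusion -/

section Normal

variable {d : ℕ} {ν : Measure (EuclideanSpace ℝ (Fin d))} [IsProbabilityMeasure ν]

lemma dotProduct_secondMomentMatrix_mulVec (hν : MemLp (fun x => x) 2 ν)
    (t : EuclideanSpace ℝ (Fin d)) :
    t.ofLp ⬝ᵥ (secondMomentMatrix ν).mulVec t.ofLp = ∫ x, ⟪x, t⟫_ℝ ^ 2 ∂ν := by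
  have hc (i) : MemLp (fun x : EuclideanSpace ℝ (Fin d) ↦ x i) 2 ν :=
    hν.of_le (by fun_prop) (.of_forall fun x ↦ PiLp.norm_apply_le x i)
  have hij (i j) : Integrable (fun x : EuclideanSpace ℝ (Fin d) ↦ x i * x j) ν :=
    (hc i).integrable_mul (hc j)
  have h (x : EuclideanSpace ℝ (Fin d)) :
      ⟪x, t⟫_ℝ ^ 2 = ∑ i, ∑ j, t i * t j * (x i * x j) := by
    rw [PiLp.inner_apply, sq, Finset.sum_mul_sum]
    refine Finset.sum_congr rfl fun i _ ↦ Finset.sum_congr rfl fun j _ ↦ ?_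
    simp only [RCLike.inner_apply, conj_trivial]
    ring
  simp_rw [h]
  rw [integral_finsetSum _ fun i _ ↦ integrable_finsetSum _ fun j _ ↦ (hij i j).const_mul _]
  simp_rw [dotProduct, Matrix.mulVec, dotProduct, Finset.mul_sum]
  refine Finset.sum_congr rfl fun i _ ↦ ?_
  rw [integral_finsetSum _ fun j _ ↦ (hij i j).const_mul _]
  refine Finset.sum_congr rfl fun j _ ↦ ?_
  rw [integral_const_mul, secondMomentMatrix, Matrix.of_apply]
  ring

/-- The quadratic form is `E⟪η, t⟫²`. The formula for the Gaussian characteristic function requires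
this positivity. -/
lemma posSemidef_secondMomentMatrix (hν : MemLp (fun x => x) 2 ν) :
    (secondMomentMatrix ν).PosSemidef := by
  refine .of_dotProduct_mulVec_nonneg ?_ fun x ↦ ?_
  · ext i j
    simp [secondMomentMatrix, mul_comm]
  · have h := dotProduct_secondMomentMatrix_mulVec hν (WithLp.toLp 2 x)
    simp only at h
    rw [star_trivial, h]
    exact integral_nonneg fun _ ↦ sq_nonneg _

lemma charFun_centredNormal_secondMomentMatrix (hν : MemLp (fun x => x) 2 ν)
    (t : EuclideanSpace ℝ (Fin d)) :
    charFun (centredNormal (secondMomentMatrix ν) : Measure (EuclideanSpace ℝ (Fin d))) t =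
      Complex.exp (-(∫ x, ⟪x, t⟫_ℝ ^ 2 ∂ν : ℝ) / 2) := by
  change charFun (multivariateGaussian 0 (secondMomentMatrix ν)) t = _
  rw [charFun_multivariateGaussian (posSemidef_secondMomentMatrix hν),
    dotProduct_secondMomentMatrix_mulVec hν]
  simp [neg_div]

end Normal

theorem IsReinforcedWalk.ae_tendsto_rescale {d : ℕ} {Ω : Type*} {mΩ : MeasurableSpace Ω}
    {P : Measure Ω} [IsProbabilityMeasure P] {ℱ : Filtration ℕ mΩ}
    {ν : Measure (EuclideanSpace ℝ (Fin d))} [IsProbabilityMeasure ν]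
    (hν : MemLp (fun x => x) 2 ν) {w : ℝ}
    {μ : ℕ → Ω → ProbabilityMeasure (EuclideanSpace ℝ (Fin d))}
    {R : ℕ → Ω → Measure (EuclideanSpace ℝ (Fin d))}
    (hU : IsReinforcedWalk P ℱ ν w (fun n ω ↦ (μ n ω : Measure (EuclideanSpace ℝ (Fin d)))) R) :
    ∀ᵐ ω ∂P, Tendsto
      (fun n : ℕ ↦ rescale (Real.sqrt (Real.log n)) (Real.log n • ∫ x, x ∂ν) (μ n ω))
      atTop (𝓝 (centredNormal (secondMomentMatrix ν))) := by
  filter_upwards [hU.ae_tendsto_rescaledCharFun hν (charFun_centredNormal_secondMomentMatrix hν)]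
    with ω hω
  -- Lévy's continuity theorem.
  rw [ProbabilityMeasure.tendsto_iff_tendsto_charFun]
  refine fun t ↦ (hω t).congr fun n ↦ ?_
  rw [← charFun_map_smul_sub]
  rfl

theorem theorem1p1 {d : ℕ} {Ω : Type*} {mΩ : MeasurableSpace Ω}
    (P : Measure Ω) [IsProbabilityMeasure P]
    (ν : Measure (EuclideanSpace ℝ (Fin d))) [IsProbabilityMeasure ν]
    (hν : MemLp (fun x => x) 2 ν)
    (μ₀ : FiniteMeasure (EuclideanSpace ℝ (Fin d))) (hμ₀ : μ₀ ≠ 0)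
    (ℱ : Filtration ℕ mΩ)
    (μ : ℕ → Ω → FiniteMeasure (EuclideanSpace ℝ (Fin d)))
    (X : ℕ → Ω → EuclideanSpace ℝ (Fin d)) :
    ((∃ η : ℕ → Ω → EuclideanSpace ℝ (Fin d), IsSRWPolyaUrn P ℱ ν μ₀ μ X η) →
      ∀ᵐ ω ∂P, Tendsto
        (fun n : ℕ => rescale (Real.sqrt (Real.log n)) (Real.log n • ∫ x, x ∂ν) (μ n ω).normalize)
        atTop (𝓝 (centredNormal (secondMomentMatrix ν)))) ∧
    (IsDRWPolyaUrn P ℱ ν μ₀ μ X →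
      ∀ᵐ ω ∂P, Tendsto
        (fun n : ℕ => rescale (Real.sqrt (Real.log n)) (Real.log n • ∫ x, x ∂ν) (μ n ω).normalize)
        atTop (𝓝 (centredNormal (secondMomentMatrix ν)))) := by
  refine ⟨?_, fun hU ↦ (hU.isReinforcedWalk hμ₀).ae_tendsto_rescale hν⟩
  rintro ⟨η, hU⟩
  exact (hU.isReinforcedWalk hμ₀).ae_tendsto_rescale hν
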